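/- Let $n\ge 2$ and $\lambda>0$. There is a constant $C=C(n,\lambda)>0$ such that the following holds for all $\sigma\in(0,2)$ and all $\Lambda$ with $\lambda\le n\Lambda$. Write $B_r$ for the open ball of radius $r$ about $0$ in $\mathbb R^n$, $\delta v(x,y)=v(x+y)+v(x-y)-2v(x)$, and $A(n,\alpha)=\pi^{\alpha-n/2}\,\mathbf\Gamma(\tfrac{n-\alpha}{2})/\mathbf\Gamma(\tfrac{\alpha}{2})$, where $\mathbf\Gamma$ is Euler's Gamma function. Put $K_\alpha(y)=A(n,\alpha)|y|^{-n+\alpha}$ and $$M^-(v,x)=\inf\Big\{(2-\sigma)\int_{\mathbb R^n}\delta v(x,y)\frac{y^TAy}{|y|^{n+\sigma+2}}\,dy\;:\;A\ge 0\text{ symmetric},\ \operatorname{Tr}A\ge\lambda,\ A\le\Lambda\,\mathrm{Id}\Big\},$$ $$E_\sigma(v,x)=\inf_{|\tau|=1}\langle h_\sigma(v,x)\tau,\tau\rangle,\qquad h_\sigma(v,x)=\tfrac{(n+\sigma-2)(n+\sigma)}{2}A(n,2-\sigma)\int_{\mathbb R^n}\frac{y\otimes y}{|y|^{n+\sigma+2}}\,\delta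 v(x,y)\,dy .$$ Let $f\in C(\overline{B_1})$ with $f\ge0$, and let $u:\mathbb R^n\to\mathbb R$ be bounded and lower semicontinuous with $u\le0$ in $B_1$, $u\ge0$ in $\mathbb R^n\setminus B_1$, and $M^-(u,\cdot)\le f$ in $B_1$ in the viscosity sense. Let $$\Gamma(x)=\sup\big\{v(x): v\text{ bounded and upper semicontinuous},\ E_\sigma(v,\cdot)\ge0\text{ in }B_3\text{ in the viscosity sense},\ v\le u\mathbf 1_{B_1}\text{ in }\mathbb R^n\big\}$$ and $P=\Gamma*K_{2-\sigma}$. (Viscosity sense: whenever a $C^2$ function $\varphi$ touches the function from below, respectively above, at $x$ in a ball around $x$ contained in the domain, the inequality holds at $x$ for the function equal to $\varphi$ in that ball and to the given function elsewhere.) Let $x_0$ satisfy $\Gamma(x_0)=\inf_{\mathbb R^n}\Gamma$. Then the convolution defining $P$ converges absolutely at every point, $P$ is bounded below, if $\Gamma(x_0)<0$ then $x_0\in B_1$ and $f(x_0)>0$, and $$-\inf_{\mathbb R^n}P=-\inf_{B_3}P\;\ge\;C(n,\lambda)\,\big(-\Gamma(x_0)\big)^{2/\sigma}\Big(\frac{1}{2f(x_0)}\Big)^{(2-\sigma)/\sigma},$$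 where the right-hand side is read as $0$ if $\Gamma(x_0)=0$. -/

import Mathlib

open MeasureTheory Metric
open scoped Convolution Matrix

namespace FracABP

/-- Euclidean space `ℝⁿ`. -/
abbrev Rn (n : ℕ) := EuclideanSpace ℝ (Fin n)

/-- The second difference `δv(x,y) = v(x+y) + v(x-y) - 2 v(x)`. -/
def secondDiff {n : ℕ} (v : Rn n → ℝ) (x y : Rn n) : ℝ :=
  v (x + y) + v (x - y) - 2 * v x

/-- The constant `A(n,α) = π^(α - n/2) Γ((n-α)/2) / Γ(α/2)` (Euler's Gamma function). -/
noncomputable def rieszConst (n : ℕ) (α : ℝ) : ℝ :=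
  Real.pi ^ (α - (n : ℝ) / 2) * Real.Gamma (((n : ℝ) - α) / 2) / Real.Gamma (α / 2)

/-- The Riesz kernel `K_α(y) = A(n,α) |y|^(-n+α)`. -/
noncomputable def rieszKernel (n : ℕ) (α : ℝ) (y : Rn n) : ℝ :=
  rieszConst n α * ‖y‖ ^ (-(n : ℝ) + α)

/-- The linear operator `(2-σ) ∫ δv(x,y) (yᵀ A y) / |y|^(n+σ+2) dy`. -/
noncomputable def linOp {n : ℕ} (σ : ℝ) (A : Matrix (Fin n) (Fin n) ℝ)
    (v : Rn n → ℝ) (x : Rn n) : ℝ :=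
  (2 - σ) * ∫ y : Rn n,
    secondDiff v x y * ((y.ofLp ⬝ᵥ (A *ᵥ y.ofLp)) / ‖y‖ ^ ((n : ℝ) + σ + 2))

/-- The admissible coefficient matrices: `A ≥ 0`, `Tr A ≥ lam`, `A ≤ Lam Id`. -/
def ellipticMatrices (n : ℕ) (lam Lam : ℝ) : Set (Matrix (Fin n) (Fin n) ℝ) :=
  {A | A.PosSemidef ∧ lam ≤ A.trace ∧ (Lam • (1 : Matrix (Fin n) (Fin n) ℝ) - A).PosSemidef}

/-- The minimal operator `M⁻(v,x)`, an infimum of `linOp` over the admissible matrices. -/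
noncomputable def minOp {n : ℕ} (σ lam Lam : ℝ) (v : Rn n → ℝ) (x : Rn n) : ℝ :=
  sInf ((fun A => linOp σ A v x) '' ellipticMatrices n lam Lam)

/-- The integro-differential Hessian
`h_σ(v,x) = ((n+σ-2)(n+σ)/2) A(n,2-σ) ∫ (y ⊗ y)/|y|^(n+σ+2) δv(x,y) dy`. -/
noncomputable def fracHessian {n : ℕ} (σ : ℝ) (v : Rn n → ℝ) (x : Rn n) :
    Matrix (Fin n) (Fin n) ℝ :=
  Matrix.of fun i j =>
    (((n : ℝ) + σ - 2) * ((n : ℝ) + σ) / 2) * rieszConst n (2 - σ) *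
      ∫ y : Rn n, y i * y j / ‖y‖ ^ ((n : ℝ) + σ + 2) * secondDiff v x y

/-- `E_σ(v,x)`: the first eigenvalue of `h_σ(v,x)`, as `inf_{|τ|=1} ⟨h_σ(v,x) τ, τ⟩`. -/
noncomputable def firstEig {n : ℕ} (σ : ℝ) (v : Rn n → ℝ) (x : Rn n) : ℝ :=
  ⨅ τ : sphere (0 : Rn n) 1, (fracHessian σ v x *ᵥ τ.1.ofLp) ⬝ᵥ τ.1.ofLp

/-- The function equal to `φ` in the ball `B_r(x)` and to `v` elsewhere. -/
noncomputable def splice {n : ℕ} (φ v : Rn n → ℝ) (x : Rn n) (r : ℝ) (z : Rn n) : ℝ :=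
  if dist z x < r then φ z else v z

/-- `I(v,·) ≥ 0` in `Ω` in the viscosity sense, for a nonlocal operator `I`: whenever a `C²`
function `φ` touches `v` from above at `x ∈ Ω` in a ball `B_r(x) ⊆ Ω`, the function equal to `φ` in
`B_r(x)` and to `v` elsewhere satisfies the inequality classically at `x`. -/
def ViscSubsol {n : ℕ} (I : (Rn n → ℝ) → Rn n → ℝ) (Ω : Set (Rn n)) (v : Rn n → ℝ) : Prop :=
  ∀ x ∈ Ω, ∀ r : ℝ, 0 < r → ball x r ⊆ Ω → ∀ φ : Rn n → ℝ, ContDiff ℝ 2 φ →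
    φ x = v x → (∀ z ∈ ball x r, v z ≤ φ z) → 0 ≤ I (splice φ v x r) x

/-- `I(u,·) ≤ f` in `Ω` in the viscosity sense (test functions touching from below). -/
def ViscSupersol {n : ℕ} (I : (Rn n → ℝ) → Rn n → ℝ) (f : Rn n → ℝ) (Ω : Set (Rn n))
    (u : Rn n → ℝ) : Prop :=
  ∀ x ∈ Ω, ∀ r : ℝ, 0 < r → ball x r ⊆ Ω → ∀ φ : Rn n → ℝ, ContDiff ℝ 2 φ →
    φ x = u x → (∀ z ∈ ball x r, φ z ≤ u z) → I (splice φ u x r) x ≤ f x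

/-- The competitors in the definition of the envelope of `u`: bounded upper semicontinuous `v` with
`E_σ(v) ≥ 0` in `B_3` (viscosity sense) and `v ≤ u 1_{B_1}` in `ℝⁿ`. -/
def envelopeClass {n : ℕ} (σ : ℝ) (u : Rn n → ℝ) : Set (Rn n → ℝ) :=
  {v | UpperSemicontinuous v ∧ (∃ M : ℝ, ∀ x, |v x| ≤ M) ∧
    ViscSubsol (firstEig σ) (ball 0 3) v ∧ ∀ x, v x ≤ (ball (0 : Rn n) 1).indicator u x}

/-- The `σ`-order envelope of `u`: the pointwise supremum of the competitors. -/
noncomputable def envelope {n : ℕ} (σ : ℝ) (u : Rn n → ℝ) (x : Rn n) : ℝ :=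
  sSup ((fun v : Rn n → ℝ => v x) '' envelopeClass σ u)

/-- The Riesz potential `P = Γ * K_{2-σ}` of the envelope `Γ` of `u`. -/
noncomputable def potential {n : ℕ} (σ : ℝ) (u : Rn n → ℝ) : Rn n → ℝ :=
  envelope σ u ⋆ rieszKernel n (2 - σ)

end FracABP

/-! Let q be `obstacle u`, that is `u` cut off to B_1, and let m be its minimum, which is attained
since q = min(u,0) is lower semicontinuous and vanishes off B_1. The function equal to m in B_3 and
to 0 outside is a competitor, so m ≤ Γ ≤ q ≤ 0 and min Γ = m. Suppose m < 0. The jump of this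
competitor across the boundary of B_3 makes its directional integrals uniformly positive in B_3, so
a small bump can be added wherever q > m (`lt_envelope_of_lt_obstacle`). Hence Γ > m there, and x₀
must be a point of B_1 with u(x₀) = m: the constant m touches u from below at x₀.

The estimate comes from integrating one pointwise inequality, -m ≤ b + (u - m) with b = -q, around
x₀ against min(|y|²,ρ²) yᵀAy/|y|^(n+σ+2). The left side has a radial weight, hence sees only Tr A
and is a multiple of Tr A (-m) ρ^(2-σ). On the right, bounding the minimum by |y|² turns b into Tr A
times its Riesz potential, and bounding it by ρ² turns u - m into ρ² times the operator at x₀, which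
the equation controls (`linOp_splice_ge`, `supersol_estimate`). Only Tr A ≥ λ enters the constant,
so it does not depend on Λ. Optimizing in ρ (`optimize_scale`) gives a lower bound for (2-σ) times
the potential of -q, and since A(n,2-σ) ≥ c(n)(2-σ) (`rieszConst_ge`) and -Γ ≥ -q, the same bound
holds for -P(x₀).

The convolution needs Γ measurable, although Γ is a supremum of an uncountable family. A
subsolution's superlevel sets never have density zero at their own points in B_3
(`ViscSubsol.not_tendsto_density`), and by Lebesgue density a union of such sets is null measurable.
Finally -Γ is bounded and supported in B_3, so its potential does not decrease under radial
projection onto the closed ball, and Fatou along rays reduces the infimum of P to the open ball B_3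
(`IsDensity.sInf_eq`). -/

namespace FracABP

/-! ### Quadratic forms integrated against radial weights -/

/-- The quadratic form `yᵀ A y`. -/
noncomputable def quadForm {n : ℕ} (A : Matrix (Fin n) (Fin n) ℝ) (y : Rn n) : ℝ :=
  y.ofLp ⬝ᵥ (A *ᵥ y.ofLp)

lemma quadForm_eq_sum {n : ℕ} (A : Matrix (Fin n) (Fin n) ℝ) (y : Rn n) :
    quadForm A y = ∑ i, ∑ j, A i j * (y i * y j) := by
  simp only [quadForm, dotProduct, Matrix.mulVec, Finset.mul_sum]
  refine Finset.sum_congr rfl fun i _ => Finset.sum_congr rfl fun j _ => by ring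

lemma quadForm_nonneg {n : ℕ} {A : Matrix (Fin n) (Fin n) ℝ} (hA : A.PosSemidef) (y : Rn n) :
    0 ≤ quadForm A y := by
  have := hA.dotProduct_mulVec_nonneg y.ofLp
  simpa [quadForm] using this

lemma abs_mul_le_norm_sq {n : ℕ} (y : Rn n) (i j : Fin n) : |y i * y j| ≤ ‖y‖ ^ 2 := by
  have h1 : |y i| ≤ ‖y‖ := PiLp.norm_apply_le y i
  have h2 : |y j| ≤ ‖y‖ := PiLp.norm_apply_le y j
  rw [abs_mul, sq]
  gcongr

-- Factor A = BᴴB: the form is |By|², the trace is the squared Frobenius norm of B, and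
-- Cauchy-Schwarz on each row compares them. A bound by the trace is what keeps Λ out of the
-- estimates.
open scoped MatrixOrder Matrix.Norms.L2Operator in
lemma quadForm_le {n : ℕ} {A : Matrix (Fin n) (Fin n) ℝ} (hA : A.PosSemidef) (y : Rn n) :
    quadForm A y ≤ A.trace * ‖y‖ ^ 2 := by
  obtain ⟨B, rfl⟩ : ∃ B : Matrix (Fin n) (Fin n) ℝ, A = Bᴴ * B := by
    exact CStarAlgebra.nonneg_iff_eq_star_mul_self.mp hA.nonneg
  have h1 : quadForm (Bᴴ * B) y = ∑ i, (∑ j, B i j * y j) ^ 2 := by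
    simp only [quadForm, ← Matrix.mulVec_mulVec, Matrix.conjTranspose_eq_transpose_of_trivial]
    rw [Matrix.dotProduct_mulVec, Matrix.vecMul_transpose]
    simp [dotProduct, Matrix.mulVec, sq]
  have h2 : (Bᴴ * B).trace = ∑ i, ∑ j, B i j ^ 2 := by
    simp only [Matrix.trace, Matrix.diag, Matrix.mul_apply, Matrix.conjTranspose_apply,
      star_trivial]
    rw [Finset.sum_comm]
    simp [sq]
  rw [h1, h2, EuclideanSpace.norm_sq_eq, Finset.sum_mul]
  refine Finset.sum_le_sum fun i _ => ?_
  simpa using Finset.sum_mul_sq_le_sq_mul_sq Finset.univ (fun j => B i j) (fun j => y j)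

lemma integrable_radial_mul_mul {n : ℕ} {g : ℝ → ℝ} (hm : Measurable g)
    (hg : Integrable fun y : Rn n => g ‖y‖ * ‖y‖ ^ 2) (i j : Fin n) :
    Integrable fun y : Rn n => g ‖y‖ * (y i * y j) := by
  refine hg.mono ?_ ?_
  · refine Measurable.aestronglyMeasurable ?_
    exact (hm.comp measurable_norm).mul (by fun_prop)
  · refine Filter.Eventually.of_forall fun y => ?_
    simp only [norm_mul, Real.norm_eq_abs, abs_pow, abs_norm]
    rw [← abs_mul]
    gcongr
    exact abs_mul_le_norm_sq y i j

/-- Flipping the sign of the i-th coordinate preserves the measure and the norm but changes the sign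
of the integrand. -/
lemma integral_radial_mul_of_ne {n : ℕ} (g : ℝ → ℝ) {i j : Fin n} (hij : i ≠ j) :
    ∫ y : Rn n, g ‖y‖ * (y i * y j) = 0 := by
  let e : Rn n ≃ₗᵢ[ℝ] Rn n := LinearIsometryEquiv.piLpCongrRight 2 (fun k =>
    if k = i then LinearIsometryEquiv.neg ℝ else LinearIsometryEquiv.refl ℝ ℝ)
  have h := (LinearIsometryEquiv.measurePreserving e).integral_comp
    e.toHomeomorph.measurableEmbedding (fun y : Rn n => g ‖y‖ * (y i * y j))
  have h2 : ∀ y : Rn n, g ‖e y‖ * (e y i * e y j) = -(g ‖y‖ * (y i * y j)) := by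
    intro y
    have hi : e y i = -y i := by simp [e]
    have hj : e y j = y j := by simp [e, hij.symm]
    rw [LinearIsometryEquiv.norm_map, hi, hj]; ring
  simp only [h2, integral_neg] at h
  linarith

lemma integral_radial_sq_eq {n : ℕ} (g : ℝ → ℝ) (i j : Fin n) :
    ∫ y : Rn n, g ‖y‖ * (y i * y i) = ∫ y : Rn n, g ‖y‖ * (y j * y j) := by
  let e : Rn n ≃ₗᵢ[ℝ] Rn n := LinearIsometryEquiv.piLpCongrLeft 2 ℝ ℝ (Equiv.swap i j)
  have h := (LinearIsometryEquiv.measurePreserving e).integral_comp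
    e.toHomeomorph.measurableEmbedding (fun y : Rn n => g ‖y‖ * (y i * y i))
  rw [← h]
  congr 1
  ext y
  have hi : e y i = y j := by simp [e, LinearIsometryEquiv.piLpCongrLeft_apply]
  rw [LinearIsometryEquiv.norm_map, hi]

lemma integral_radial_sq {n : ℕ} {g : ℝ → ℝ} (hm : Measurable g)
    (hg : Integrable fun y : Rn n => g ‖y‖ * ‖y‖ ^ 2) (i : Fin n) :
    ∫ y : Rn n, g ‖y‖ * (y i * y i) = (∫ y : Rn n, g ‖y‖ * ‖y‖ ^ 2) / n := by
  have h : ∫ y : Rn n, g ‖y‖ * ‖y‖ ^ 2 = ∑ j : Fin n, ∫ y : Rn n, g ‖y‖ * (y j * y j) := by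
    rw [← integral_finsetSum _ fun j _ => integrable_radial_mul_mul hm hg j j]
    congr 1; ext y
    rw [EuclideanSpace.norm_sq_eq, Finset.mul_sum]
    simp [sq]
  have hn : (n : ℝ) ≠ 0 := by
    have := i.pos
    positivity
  rw [h, Finset.sum_congr rfl fun j _ => integral_radial_sq_eq g j i]
  simp
  field_simp

lemma integrable_radial_quadForm {n : ℕ} (A : Matrix (Fin n) (Fin n) ℝ) {g : ℝ → ℝ}
    (hm : Measurable g) (hg : Integrable fun y : Rn n => g ‖y‖ * ‖y‖ ^ 2) :
    Integrable fun y : Rn n => g ‖y‖ * quadForm A y := by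
  simp only [quadForm_eq_sum, Finset.mul_sum]
  refine integrable_finsetSum _ fun i _ => integrable_finsetSum _ fun j _ => ?_
  exact ((integrable_radial_mul_mul hm hg i j).const_mul (A i j)).congr
    (Filter.Eventually.of_forall fun y => by ring)

/-- A radial weight sees only the trace of a quadratic form. -/
lemma integral_radial_quadForm {n : ℕ} (A : Matrix (Fin n) (Fin n) ℝ) {g : ℝ → ℝ}
    (hm : Measurable g) (hg : Integrable fun y : Rn n => g ‖y‖ * ‖y‖ ^ 2) :
    ∫ y : Rn n, g ‖y‖ * quadForm A y = A.trace / n * ∫ y : Rn n, g ‖y‖ * ‖y‖ ^ 2 := by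
  have hint : ∀ i j, Integrable fun y : Rn n => A i j * (g ‖y‖ * (y i * y j)) := fun i j =>
    (integrable_radial_mul_mul hm hg i j).const_mul (A i j)
  have h1 : ∀ y : Rn n, g ‖y‖ * quadForm A y = ∑ i, ∑ j, A i j * (g ‖y‖ * (y i * y j)) := by
    intro y
    rw [quadForm_eq_sum, Finset.mul_sum]
    refine Finset.sum_congr rfl fun i _ => ?_
    rw [Finset.mul_sum]
    refine Finset.sum_congr rfl fun j _ => by ring
  simp only [h1]
  rw [integral_finsetSum _ fun i _ => integrable_finsetSum _ fun j _ => hint i j]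
  have h2 : ∀ i : Fin n, ∫ y : Rn n, ∑ j, A i j * (g ‖y‖ * (y i * y j)) =
      A i i * ((∫ y : Rn n, g ‖y‖ * ‖y‖ ^ 2) / n) := by
    intro i
    rw [integral_finsetSum _ fun j _ => hint i j, Finset.sum_eq_single i]
    · rw [integral_const_mul, integral_radial_sq hm hg]
    · intro j _ hj
      rw [integral_const_mul, integral_radial_mul_of_ne g hj.symm, mul_zero]
    · simp
  rw [Finset.sum_congr rfl fun i _ => h2 i, ← Finset.sum_mul, Matrix.trace]
  simp only [Matrix.diag]
  ring

/-! ### The truncated power weight in polar coordinates -/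

section Radial
variable {n : ℕ} {σ : ℝ}

lemma integrableOn_Ioi_truncated (hσ : 0 < σ) (hσ2 : σ < 2) {ρ : ℝ} (hρ : 0 < ρ) :
    IntegrableOn (fun r : ℝ => min (r ^ 2) (ρ ^ 2) * r ^ (-1 - σ)) (Set.Ioi 0) ∧
    ∫ r in Set.Ioi (0 : ℝ), min (r ^ 2) (ρ ^ 2) * r ^ (-1 - σ) =
      ρ ^ (2 - σ) * (2 / (σ * (2 - σ))) := by
  have e1 : Set.EqOn (fun r : ℝ => min (r ^ 2) (ρ ^ 2) * r ^ (-1 - σ))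
      (fun r => r ^ (1 - σ)) (Set.Ioc 0 ρ) := by
    intro r hr
    have : r ^ 2 ≤ ρ ^ 2 := by have := hr.1.le; have := hr.2; gcongr
    simp only [min_eq_left this]
    rw [← Real.rpow_natCast, ← Real.rpow_add hr.1]
    congr 1; push_cast; ring
  have e2 : Set.EqOn (fun r : ℝ => min (r ^ 2) (ρ ^ 2) * r ^ (-1 - σ))
      (fun r => ρ ^ 2 * r ^ (-1 - σ)) (Set.Ioi ρ) := by
    intro r hr
    have : ρ ^ 2 ≤ r ^ 2 := by have : ρ < r := hr; gcongr
    simp only [min_eq_right this]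
  have i1 : IntegrableOn (fun r : ℝ => min (r ^ 2) (ρ ^ 2) * r ^ (-1 - σ)) (Set.Ioc 0 ρ) := by
    rw [integrableOn_congr_fun e1 measurableSet_Ioc]
    rw [← intervalIntegrable_iff_integrableOn_Ioc_of_le hρ.le]
    exact intervalIntegral.intervalIntegrable_rpow' (by linarith)
  have i2 : IntegrableOn (fun r : ℝ => min (r ^ 2) (ρ ^ 2) * r ^ (-1 - σ)) (Set.Ioi ρ) := by
    rw [integrableOn_congr_fun e2 measurableSet_Ioi]
    exact (integrableOn_Ioi_rpow_of_lt (by linarith) hρ).const_mul _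
  rw [← Set.Ioc_union_Ioi_eq_Ioi hρ.le]
  refine ⟨i1.union i2, ?_⟩
  rw [setIntegral_union Set.Ioc_disjoint_Ioi_same measurableSet_Ioi i1 i2,
    setIntegral_congr_fun measurableSet_Ioc e1, setIntegral_congr_fun measurableSet_Ioi e2,
    ← intervalIntegral.integral_of_le hρ.le, integral_rpow (Or.inl (by linarith)),
    integral_const_mul, integral_Ioi_rpow_of_lt (by linarith) hρ, Real.zero_rpow (by linarith)]
  have h3 : ρ ^ (2 : ℕ) * ρ ^ (-1 - σ + 1) = ρ ^ (2 - σ) := by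
    rw [← Real.rpow_natCast, ← Real.rpow_add hρ]
    congr 1; push_cast; ring
  have h4 : ρ ^ (2 : ℕ) * (-ρ ^ (-1 - σ + 1) / (-1 - σ + 1)) = ρ ^ (2 - σ) / σ := by
    rw [← h3]
    have : (-1 - σ + 1) = -σ := by ring
    rw [this]; field_simp
  rw [h4]
  have : 1 - σ + 1 = 2 - σ := by ring
  rw [this]
  have : 2 - σ ≠ 0 := by linarith
  field_simp
  ring

lemma pow_mul_rpow_neg (hn : 1 ≤ n) {r : ℝ} (hr : 0 < r) :
    r ^ (n - 1) * r ^ (-(n : ℝ) - σ) = r ^ (-1 - σ) := by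
  rw [← Real.rpow_natCast, ← Real.rpow_add hr]
  congr 1
  push_cast [hn]; ring

/-- Truncated radial weight: integrability and value. -/
lemma integral_truncated_weight (hn : 2 ≤ n) (hσ : 0 < σ) (hσ2 : σ < 2) {ρ : ℝ} (hρ : 0 < ρ) :
    Integrable (fun y : Rn n => min (‖y‖ ^ 2) (ρ ^ 2) * ‖y‖ ^ (-(n : ℝ) - σ)) ∧
    ∫ y : Rn n, min (‖y‖ ^ 2) (ρ ^ 2) * ‖y‖ ^ (-(n : ℝ) - σ) =
      n * volume.real (ball (0 : Rn n) 1) * (ρ ^ (2 - σ) * (2 / (σ * (2 - σ)))) := by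
  have : NeZero n := ⟨by omega⟩
  obtain ⟨h1, h2⟩ := integrableOn_Ioi_truncated hσ hσ2 hρ
  have e : Set.EqOn (fun y : ℝ => y ^ (Module.finrank ℝ (Rn n) - 1) •
      (min (y ^ 2) (ρ ^ 2) * y ^ (-(n : ℝ) - σ)))
      (fun r : ℝ => min (r ^ 2) (ρ ^ 2) * r ^ (-1 - σ)) (Set.Ioi 0) := by
    intro r hr
    simp only [finrank_euclideanSpace, Fintype.card_fin, smul_eq_mul]
    rw [← pow_mul_rpow_neg (n := n) (by omega) hr]; ring
  constructor
  · have := integrable_fun_norm_addHaar (volume : Measure (Rn n))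
      (f := fun r => min (r ^ 2) (ρ ^ 2) * r ^ (-(n : ℝ) - σ))
    rw [this, integrableOn_congr_fun e measurableSet_Ioi]
    exact h1
  · have := integral_fun_norm_addHaar (volume : Measure (Rn n))
      (fun r => min (r ^ 2) (ρ ^ 2) * r ^ (-(n : ℝ) - σ))
    rw [this, setIntegral_congr_fun measurableSet_Ioi e, h2]
    simp [mul_assoc]

end Radial
-- The matrix kernel and the fractional Hessian as directional integrals
section Kernel
variable {n : ℕ} {σ : ℝ}

/-- The kernel `yᵀ A y / |y|^(n+σ+2)`. -/
noncomputable def quadKernel (σ : ℝ) (A : Matrix (Fin n) (Fin n) ℝ) (y : Rn n) : ℝ :=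
  quadForm A y / ‖y‖ ^ ((n : ℝ) + σ + 2)

lemma linOp_eq (A : Matrix (Fin n) (Fin n) ℝ) (v : Rn n → ℝ) (x : Rn n) :
    linOp σ A v x = (2 - σ) * ∫ y, secondDiff v x y * quadKernel σ A y := rfl

/-- At the origin both sides vanish by the convention that zero to a nonzero real power is zero, so
the identity needs no exceptional point. -/
lemma inv_rpow_mul_norm_sq (hσ : 0 < σ) (y : Rn n) :
    (‖y‖ ^ ((n : ℝ) + σ + 2))⁻¹ * ‖y‖ ^ 2 = ‖y‖ ^ (-(n : ℝ) - σ) := by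
  rcases eq_or_ne y 0 with rfl | hy
  · have : -(n : ℝ) - σ ≠ 0 := by have : (0 : ℝ) ≤ n := n.cast_nonneg; linarith
    simp [Real.zero_rpow this]
  · have hy' : 0 < ‖y‖ := norm_pos_iff.mpr hy
    rw [← Real.rpow_neg hy'.le, ← Real.rpow_natCast, ← Real.rpow_add hy']
    congr 1; push_cast; ring

lemma quadKernel_nonneg {A : Matrix (Fin n) (Fin n) ℝ} (hA : A.PosSemidef) (y : Rn n) :
    0 ≤ quadKernel σ A y :=
  div_nonneg (quadForm_nonneg hA y) (Real.rpow_nonneg (norm_nonneg _) _)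

lemma quadKernel_le (hσ : 0 < σ) {A : Matrix (Fin n) (Fin n) ℝ} (hA : A.PosSemidef) (y : Rn n) :
    quadKernel σ A y ≤ A.trace * ‖y‖ ^ (-(n : ℝ) - σ) := by
  rw [← inv_rpow_mul_norm_sq hσ, quadKernel, div_eq_inv_mul]
  have := quadForm_le hA y
  have h2 : 0 ≤ (‖y‖ ^ ((n : ℝ) + σ + 2))⁻¹ := by positivity
  calc _ ≤ (‖y‖ ^ ((n : ℝ) + σ + 2))⁻¹ * (A.trace * ‖y‖ ^ 2) := by gcongr
    _ = _ := by ring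

lemma integrable_radial_quadKernel (hσ : 0 < σ) (A : Matrix (Fin n) (Fin n) ℝ) {h : ℝ → ℝ}
    (hm : Measurable h) (hi : Integrable fun y : Rn n => h ‖y‖ * ‖y‖ ^ (-(n : ℝ) - σ)) :
    Integrable fun y : Rn n => h ‖y‖ * quadKernel σ A y := by
  have := integrable_radial_quadForm A (g := fun r => h r * (r ^ ((n : ℝ) + σ + 2))⁻¹)
    (by fun_prop) (by simpa only [mul_assoc, inv_rpow_mul_norm_sq hσ] using hi)
  simpa only [mul_assoc, ← div_eq_inv_mul, quadKernel] using this

lemma integral_radial_quadKernel (hσ : 0 < σ) (A : Matrix (Fin n) (Fin n) ℝ) {h : ℝ → ℝ}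
    (hm : Measurable h) (hi : Integrable fun y : Rn n => h ‖y‖ * ‖y‖ ^ (-(n : ℝ) - σ)) :
    ∫ y : Rn n, h ‖y‖ * quadKernel σ A y =
      A.trace / n * ∫ y : Rn n, h ‖y‖ * ‖y‖ ^ (-(n : ℝ) - σ) := by
  have := integral_radial_quadForm A (g := fun r => h r * (r ^ ((n : ℝ) + σ + 2))⁻¹)
    (by fun_prop) (by simpa only [mul_assoc, inv_rpow_mul_norm_sq hσ] using hi)
  simpa only [mul_assoc, ← div_eq_inv_mul, inv_rpow_mul_norm_sq hσ, quadKernel] using this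

/-- Functions vanishing quadratically at the origin and bounded. -/
def QuadBound (C : ℝ) (D : Rn n → ℝ) : Prop := ∀ y, |D y| ≤ C * min (‖y‖ ^ 2) 1

lemma integrable_min_weight (hn : 2 ≤ n) (hσ : 0 < σ) (hσ2 : σ < 2) :
    Integrable (fun y : Rn n => min (‖y‖ ^ 2) 1 * ‖y‖ ^ (-(n : ℝ) - σ)) := by
  simpa using (integral_truncated_weight (n := n) hn hσ hσ2 one_pos).1

lemma QuadBound.integrable_entry (hn : 2 ≤ n) (hσ : 0 < σ) (hσ2 : σ < 2) {C : ℝ} {D : Rn n → ℝ}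
    (hD : QuadBound C D) (hm : Measurable D) (i j : Fin n) :
    Integrable fun y : Rn n => y i * y j / ‖y‖ ^ ((n : ℝ) + σ + 2) * D y := by
  refine ((integrable_min_weight hn hσ hσ2).const_mul C).mono' ?_ ?_
  · exact Measurable.aestronglyMeasurable (by fun_prop)
  · refine Filter.Eventually.of_forall fun y => ?_
    rw [← inv_rpow_mul_norm_sq hσ, Real.norm_eq_abs, abs_mul, abs_div,
      abs_of_nonneg (Real.rpow_nonneg (norm_nonneg y) _), div_eq_inv_mul]
    have h1 := abs_mul_le_norm_sq y i j
    have h2 := hD y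
    have h3 : 0 ≤ C * min (‖y‖ ^ 2) 1 := (abs_nonneg _).trans h2
    calc _ ≤ (‖y‖ ^ ((n : ℝ) + σ + 2))⁻¹ * ‖y‖ ^ 2 * (C * min (‖y‖ ^ 2) 1) := by gcongr
      _ = _ := by ring

lemma quadKernel_eq_sum (A : Matrix (Fin n) (Fin n) ℝ) (y : Rn n) :
    quadKernel σ A y = ∑ i, ∑ j, A i j * (y i * y j / ‖y‖ ^ ((n : ℝ) + σ + 2)) := by
  rw [quadKernel, quadForm_eq_sum, Finset.sum_div]
  refine Finset.sum_congr rfl fun i _ => ?_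
  rw [Finset.sum_div]
  refine Finset.sum_congr rfl fun j _ => by ring

lemma mul_quadKernel_eq_sum (A : Matrix (Fin n) (Fin n) ℝ) (D : Rn n → ℝ) (y : Rn n) :
    D y * quadKernel σ A y =
      ∑ i, ∑ j, A i j * (y i * y j / ‖y‖ ^ ((n : ℝ) + σ + 2) * D y) := by
  rw [quadKernel_eq_sum, Finset.mul_sum]
  refine Finset.sum_congr rfl fun i _ => ?_
  rw [Finset.mul_sum]
  refine Finset.sum_congr rfl fun j _ => by ring

lemma QuadBound.integrable (hn : 2 ≤ n) (hσ : 0 < σ) (hσ2 : σ < 2) {C : ℝ} {D : Rn n → ℝ}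
    (hD : QuadBound C D) (hm : Measurable D) (A : Matrix (Fin n) (Fin n) ℝ) :
    Integrable fun y : Rn n => D y * quadKernel σ A y := by
  simp only [mul_quadKernel_eq_sum]
  exact integrable_finsetSum _ fun i _ => integrable_finsetSum _ fun j _ =>
    (hD.integrable_entry hn hσ hσ2 hm i j).const_mul _

lemma QuadBound.integral_eq_sum (hn : 2 ≤ n) (hσ : 0 < σ) (hσ2 : σ < 2) {C : ℝ} {D : Rn n → ℝ}
    (hD : QuadBound C D) (hm : Measurable D) (A : Matrix (Fin n) (Fin n) ℝ) :
    ∫ y, D y * quadKernel σ A y =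
      ∑ i, ∑ j, A i j * ∫ y : Rn n, y i * y j / ‖y‖ ^ ((n : ℝ) + σ + 2) * D y := by
  have hi := fun i j => (hD.integrable_entry hn hσ hσ2 hm i j).const_mul (A i j)
  simp only [mul_quadKernel_eq_sum]
  rw [integral_finsetSum _ fun i _ => integrable_finsetSum _ fun j _ => hi i j]
  refine Finset.sum_congr rfl fun i _ => ?_
  rw [integral_finsetSum _ fun j _ => hi i j]
  refine Finset.sum_congr rfl fun j _ => ?_
  rw [integral_const_mul]

lemma rieszConst_pos (hn : 2 ≤ n) (hσ : 0 < σ) (hσ2 : σ < 2) : 0 < rieszConst n (2 - σ) := by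
  have hn' : (2 : ℝ) ≤ n := by exact_mod_cast hn
  unfold rieszConst
  have h1 : 0 < Real.Gamma (((n : ℝ) - (2 - σ)) / 2) := Real.Gamma_pos_of_pos (by linarith)
  have h2 : 0 < Real.Gamma ((2 - σ) / 2) := Real.Gamma_pos_of_pos (by linarith)
  have h3 : 0 < Real.pi ^ (2 - σ - (n : ℝ) / 2) := Real.rpow_pos_of_pos Real.pi_pos _
  positivity

/-- The normalizing constant of the integro-differential Hessian. -/
noncomputable def hessConst (n : ℕ) (σ : ℝ) : ℝ :=
  (((n : ℝ) + σ - 2) * ((n : ℝ) + σ) / 2) * rieszConst n (2 - σ)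

lemma hessConst_pos (hn : 2 ≤ n) (hσ : 0 < σ) (hσ2 : σ < 2) : 0 < hessConst n σ := by
  have hn' : (2 : ℝ) ≤ n := by exact_mod_cast hn
  have := rieszConst_pos hn hσ hσ2
  have h1 : 0 < (n : ℝ) + σ - 2 := by linarith
  unfold hessConst
  positivity

/-- The rank-one matrix `τ ⊗ τ`. -/
def rankOne (τ : Rn n) : Matrix (Fin n) (Fin n) ℝ := Matrix.vecMulVec τ.ofLp τ.ofLp

lemma rankOne_posSemidef (τ : Rn n) : (rankOne τ).PosSemidef := by
  simpa [rankOne] using Matrix.posSemidef_vecMulVec_self_star τ.ofLp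

lemma rankOne_trace (τ : sphere (0 : Rn n) 1) : (rankOne τ.1).trace = 1 := by
  have h : ‖τ.1‖ = 1 := by simp
  have h2 := EuclideanSpace.norm_sq_eq τ.1
  simp only [rankOne, Matrix.trace, Matrix.diag, Matrix.vecMulVec_apply]
  rw [h] at h2
  simp [sq] at h2
  linarith

lemma fracHessian_quadForm (hn : 2 ≤ n) (hσ : 0 < σ) (hσ2 : σ < 2) {C : ℝ} {w : Rn n → ℝ}
    {x : Rn n} (hD : QuadBound C (secondDiff w x)) (hm : Measurable (secondDiff w x)) (τ : Rn n) :
    (fracHessian σ w x *ᵥ τ.ofLp) ⬝ᵥ τ.ofLp =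
      hessConst n σ * ∫ y, secondDiff w x y * quadKernel σ (rankOne τ) y := by
  rw [hD.integral_eq_sum hn hσ hσ2 hm, Finset.mul_sum]
  simp only [dotProduct, Matrix.mulVec]
  refine Finset.sum_congr rfl fun i _ => ?_
  rw [Finset.mul_sum, Finset.sum_mul]
  refine Finset.sum_congr rfl fun j _ => ?_
  have h : rankOne τ i j = τ i * τ j := rfl
  rw [h]
  simp only [fracHessian, Matrix.of_apply, hessConst]
  ring

lemma firstEig_nonneg (hn : 2 ≤ n) (hσ : 0 < σ) (hσ2 : σ < 2) {C : ℝ} {w : Rn n → ℝ}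
    {x : Rn n} (hD : QuadBound C (secondDiff w x)) (hm : Measurable (secondDiff w x))
    (h : ∀ τ : sphere (0 : Rn n) 1, 0 ≤ ∫ y, secondDiff w x y * quadKernel σ (rankOne τ.1) y) :
    0 ≤ firstEig σ w x := by
  refine Real.iInf_nonneg fun τ => ?_
  rw [fracHessian_quadForm hn hσ hσ2 hD hm]
  exact mul_nonneg (hessConst_pos hn hσ hσ2).le (h τ)

lemma integral_nonneg_of_firstEig (hn : 2 ≤ n) (hσ : 0 < σ) (hσ2 : σ < 2) {C : ℝ} {w : Rn n → ℝ}
    {x : Rn n} (hD : QuadBound C (secondDiff w x)) (hm : Measurable (secondDiff w x))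
    (h : 0 ≤ firstEig σ w x) (τ : sphere (0 : Rn n) 1) :
    0 ≤ ∫ y, secondDiff w x y * quadKernel σ (rankOne τ.1) y := by
  -- Without a lower bound the real infimum would default to 0 and say nothing about a single τ;
  -- continuity on the compact sphere supplies it.
  have hb : BddBelow (Set.range fun τ : sphere (0 : Rn n) 1 =>
      (fracHessian σ w x *ᵥ τ.1.ofLp) ⬝ᵥ τ.1.ofLp) := by
    refine (isCompact_range ?_).bddBelow
    simp only [dotProduct, Matrix.mulVec]
    fun_prop
  have h1 := h.trans (ciInf_le hb τ)
  rw [fracHessian_quadForm hn hσ hσ2 hD hm] at h1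
  exact nonneg_of_mul_nonneg_right h1 (hessConst_pos hn hσ hσ2)

end Kernel

/-! ### Second differences of spliced and of compactly supported functions -/

section Splice
variable {n : ℕ}

lemma measurable_secondDiff {v : Rn n → ℝ} (hv : Measurable v) (x : Rn n) :
    Measurable (secondDiff v x) := by
  unfold secondDiff
  exact ((hv.comp (measurable_const_add x)).add (hv.comp (measurable_const.sub measurable_id))).sub
    measurable_const

lemma measurable_splice {φ v : Rn n → ℝ} (hφ : Measurable φ) (hv : Measurable v) (x : Rn n)
    (r : ℝ) : Measurable (splice φ v x r) :=
  Measurable.ite measurableSet_ball hφ hv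

lemma splice_self {φ v : Rn n → ℝ} {x : Rn n} {r : ℝ} (hr : 0 < r) : splice φ v x r x = φ x := by
  simp [splice, hr]

/-- First-order Taylor expansions at y and -y have remainder at most K|y|² by the Lipschitz
derivative; their linear terms cancel. -/
lemma abs_secondDiff_le {φ : Rn n → ℝ} (hφ : ContDiff ℝ 2 φ) {x : Rn n} {r : ℝ} {K : NNReal}
    (hK : LipschitzOnWith K (fderiv ℝ φ) (closedBall x r)) {y : Rn n} (hy : ‖y‖ ≤ r) :
    |secondDiff φ x y| ≤ 2 * K * ‖y‖ ^ 2 := by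
  have hd : Differentiable ℝ φ := hφ.differentiable (by norm_num)
  have key : ∀ y, ‖y‖ ≤ r → |φ (x + y) - φ x - fderiv ℝ φ x y| ≤ K * ‖y‖ ^ 2 := by
    intro y hy
    have hr : 0 ≤ r := (norm_nonneg y).trans hy
    have := (convex_closedBall x ‖y‖).norm_image_sub_le_of_norm_hasFDerivWithin_le'
      (f := φ) (f' := fderiv ℝ φ) (φ := fderiv ℝ φ x) (x := x) (y := x + y) (C := K * ‖y‖)
      (fun z _ => (hd z).hasFDerivAt.hasFDerivWithinAt)
      (fun z hz => by
        rw [← dist_eq_norm]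
        refine (hK.dist_le_mul z (closedBall_subset_closedBall hy hz) x
          (mem_closedBall_self hr)).trans ?_
        gcongr
        exact hz)
      (mem_closedBall_self (norm_nonneg _)) (by simp)
    simpa [mul_assoc, sq] using this
  have h2 := key y hy
  have h3 := key (-y) (by simpa using hy)
  rw [norm_neg, map_neg, ← sub_eq_add_neg] at h3
  rw [abs_le] at h2 h3 ⊢
  unfold secondDiff
  constructor <;> linarith [h2.1, h2.2, h3.1, h3.2]

/-- Second differences of a `C²` function are locally quadratically small. -/
lemma exists_secondDiff_le {φ : Rn n → ℝ} (hφ : ContDiff ℝ 2 φ) (x : Rn n) (r : ℝ) :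
    ∃ C, 0 ≤ C ∧ ∀ y, ‖y‖ ≤ r → |secondDiff φ x y| ≤ C * ‖y‖ ^ 2 := by
  have h1 : ContDiff ℝ 1 (fderiv ℝ φ) := hφ.fderiv_right (by norm_num)
  obtain ⟨K, hK⟩ := h1.contDiffOn.exists_lipschitzOnWith (s := closedBall x r) (by norm_num)
    (convex_closedBall x r) (isCompact_closedBall x r)
  exact ⟨2 * K, by positivity, fun y hy => abs_secondDiff_le hφ hK hy⟩

lemma quadBound_of_local {D : Rn n → ℝ} {r C K : ℝ} (hr : 0 < r) (hC : 0 ≤ C) (hK : 0 ≤ K)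
    (h1 : ∀ y, ‖y‖ < r → |D y| ≤ C * ‖y‖ ^ 2) (h2 : ∀ y, r ≤ ‖y‖ → |D y| ≤ K) :
    QuadBound (C + C * r ^ 2 + K / min (r ^ 2) 1) D := by
  intro y
  have hm : 0 < min (r ^ 2) 1 := by positivity
  rcases lt_or_ge ‖y‖ r with hy | hy
  · have h3 := h1 y hy
    rcases le_total (‖y‖ ^ 2) 1 with h | h
    · rw [min_eq_left h]
      refine h3.trans ?_
      gcongr
      have : 0 ≤ C * r ^ 2 + K / min (r ^ 2) 1 := by positivity
      linarith
    · rw [min_eq_right h, mul_one]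
      have : ‖y‖ ^ 2 ≤ r ^ 2 := by gcongr
      have h5 : C * ‖y‖ ^ 2 ≤ C * r ^ 2 := by gcongr
      have : 0 ≤ K / min (r ^ 2) 1 := by positivity
      linarith
  · have h3 := h2 y hy
    have h4 : min (r ^ 2) 1 ≤ min (‖y‖ ^ 2) 1 := by gcongr
    calc |D y| ≤ K / min (r ^ 2) 1 * min (r ^ 2) 1 := by rwa [div_mul_cancel₀ _ hm.ne']
      _ ≤ K / min (r ^ 2) 1 * min (‖y‖ ^ 2) 1 := by gcongr
      _ ≤ _ := by
        gcongr
        have : 0 ≤ C + C * r ^ 2 := by positivity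
        linarith

lemma secondDiff_splice_of_lt {φ v : Rn n → ℝ} {x y : Rn n} {r : ℝ} (hy : ‖y‖ < r) :
    secondDiff (splice φ v x r) x y = secondDiff φ x y := by
  have hr : 0 < r := (norm_nonneg y).trans_lt hy
  simp [secondDiff, splice, hy, hr]

lemma secondDiff_splice_of_le {φ v : Rn n → ℝ} {x y : Rn n} {r : ℝ} (hr : 0 < r) (hy : r ≤ ‖y‖) :
    secondDiff (splice φ v x r) x y = v (x + y) + v (x - y) - 2 * φ x := by
  simp [secondDiff, splice, hy.not_gt, hr]

lemma exists_quadBound_splice {φ v : Rn n → ℝ} (hφ : ContDiff ℝ 2 φ) {M : ℝ} (hv : ∀ x, |v x| ≤ M)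
    (x : Rn n) {r : ℝ} (hr : 0 < r) : ∃ C, QuadBound C (secondDiff (splice φ v x r) x) := by
  obtain ⟨C, hC, h⟩ := exists_secondDiff_le hφ x r
  have hM : 0 ≤ M := (abs_nonneg _).trans (hv x)
  refine ⟨_, quadBound_of_local hr hC (K := 2 * M + 2 * |φ x|) (by positivity) ?_ ?_⟩
  · intro y hy
    rw [secondDiff_splice_of_lt hy]
    exact h y hy.le
  · intro y hy
    rw [secondDiff_splice_of_le hr hy]
    have h1 := abs_le.mp (hv (x + y))
    have h2 := abs_le.mp (hv (x - y))
    have h3 := neg_abs_le (φ x)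
    have h4 := le_abs_self (φ x)
    rw [abs_le]
    constructor <;> linarith

/-- Second differences of a compactly supported `C²` function are uniformly quadratically small. -/
lemma exists_quadBound_of_hasCompactSupport {φ : Rn n → ℝ} (hφ : ContDiff ℝ 2 φ)
    (hs : HasCompactSupport φ) : ∃ C, 0 ≤ C ∧ ∀ x, QuadBound C (secondDiff φ x) := by
  have h1 : ContDiff ℝ 1 (fderiv ℝ φ) := hφ.fderiv_right (by norm_num)
  obtain ⟨K, hK⟩ := h1.lipschitzWith_of_hasCompactSupport (hs.fderiv ℝ) (by norm_num)
  obtain ⟨M, hM⟩ := hs.exists_bound_of_continuous hφ.continuous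
  have hM0 : 0 ≤ M := (norm_nonneg _).trans (hM 0)
  refine ⟨_, ?_, fun x => quadBound_of_local one_pos (C := 2 * K) (K := 4 * M)
    (by positivity) (by positivity) ?_ ?_⟩
  · positivity
  · intro y hy
    exact abs_secondDiff_le hφ hK.lipschitzOnWith hy.le
  · intro y _
    have h1 := abs_le.mp (hM (x + y))
    have h2 := abs_le.mp (hM (x - y))
    have h3 := abs_le.mp (hM x)
    unfold secondDiff
    rw [abs_le]
    constructor <;> linarith

end Splice
-- Barriers: a constant in B_3 lifted to zero outside, plus a perturbation
section Barrier
variable {n : ℕ} {σ : ℝ}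

lemma integrable_far_weight (hn : 2 ≤ n) (hσ : 0 < σ) (hσ2 : σ < 2) {R : ℝ} (hR : 0 < R) :
    Integrable fun y : Rn n =>
      (Set.Ici R).indicator (fun _ => (1 : ℝ)) ‖y‖ * ‖y‖ ^ (-(n : ℝ) - σ) := by
  refine ((integrable_min_weight hn hσ hσ2).const_mul (1 / min (R ^ 2) 1)).mono' ?_ ?_
  · refine Measurable.aestronglyMeasurable ?_
    exact ((measurable_const.indicator measurableSet_Ici).comp measurable_norm).mul (by fun_prop)
  · refine Filter.Eventually.of_forall fun y => ?_
    have hw : 0 ≤ ‖y‖ ^ (-(n : ℝ) - σ) := by positivity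
    have hm : 0 < min (R ^ 2) 1 := by positivity
    by_cases hy : R ≤ ‖y‖
    · have h4 : min (R ^ 2) 1 ≤ min (‖y‖ ^ 2) 1 := by gcongr
      rw [Set.indicator_of_mem (by exact hy), one_mul, Real.norm_of_nonneg hw, ← mul_assoc]
      refine le_mul_of_one_le_left hw ?_
      rw [one_div_mul_eq_div, one_le_div hm]
      exact h4
    · rw [Set.indicator_of_notMem (by exact hy)]
      simp only [zero_mul, norm_zero]
      positivity

/-- The total mass of the weight `|y|^(-n-σ)` outside `B_R`. -/
noncomputable def farMass (n : ℕ) (σ R : ℝ) : ℝ :=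
  ∫ y : Rn n, (Set.Ici R).indicator (fun _ => (1 : ℝ)) ‖y‖ * ‖y‖ ^ (-(n : ℝ) - σ)

lemma farMass_pos (hn : 2 ≤ n) (hσ : 0 < σ) (hσ2 : σ < 2) {R : ℝ} (hR : 0 < R) :
    0 < farMass n σ R := by
  have : NeZero n := ⟨by omega⟩
  unfold farMass
  rw [integral_pos_iff_support_of_nonneg _ (integrable_far_weight hn hσ hσ2 hR)]
  · have hopen : IsOpen {y : Rn n | R < ‖y‖} := isOpen_lt continuous_const continuous_norm
    have hne : {y : Rn n | R < ‖y‖}.Nonempty := by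
      obtain ⟨y, hy⟩ := NormedSpace.exists_lt_norm ℝ (Rn n) R
      exact ⟨y, hy⟩
    refine (hopen.measure_pos volume hne).trans_le (measure_mono fun y hy => ?_)
    have hy' : R < ‖y‖ := hy
    rw [Function.mem_support, Set.indicator_of_mem (by exact hy'.le), one_mul]
    exact (Real.rpow_pos_of_pos (hR.trans hy') _).ne'
  · intro y
    exact mul_nonneg (Set.indicator_nonneg (fun _ _ => zero_le_one) _) (by positivity)

/-- The constant level `m` in `B_3`, raised to `0` outside, plus a perturbation `ψ`. -/
noncomputable def barrier (m : ℝ) (ψ : Rn n → ℝ) (z : Rn n) : ℝ :=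
  m + ψ z + (ball (0 : Rn n) 3)ᶜ.indicator (fun _ => -m) z

lemma upperSemicontinuous_barrier {m : ℝ} (hm : m ≤ 0) {ψ : Rn n → ℝ} (hψ : Continuous ψ) :
    UpperSemicontinuous (barrier m ψ) := by
  unfold barrier
  refine UpperSemicontinuous.add ?_ ?_
  · exact (continuous_const.add hψ).upperSemicontinuous
  · exact isOpen_ball.isClosed_compl.upperSemicontinuous_indicator (by linarith)

/-- If |x| < 3 and |y| ≥ 6, both x + y and x - y lie outside B_3, so the jump contributes -m twice.
The bound is radial in y and uniform in x. -/
lemma barrier_secondDiff_ge {m : ℝ} (hm : m ≤ 0) {ψ : Rn n → ℝ} {c : ℝ} {x : Rn n}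
    (hψ : QuadBound c (secondDiff ψ x)) (hx : x ∈ ball (0 : Rn n) 3) (y : Rn n) :
    -c * min (‖y‖ ^ 2) 1 + 2 * (-m) * (Set.Ici (6 : ℝ)).indicator (fun _ => (1 : ℝ)) ‖y‖ ≤
      secondDiff (barrier m ψ) x y := by
  have h1 := (abs_le.mp (hψ y)).1
  have hx3 : ‖x‖ < 3 := by simpa using hx
  have hx0 : (ball (0 : Rn n) 3)ᶜ.indicator (fun _ => -m) x = 0 :=
    Set.indicator_of_notMem (Set.notMem_compl_iff.mpr hx) _
  have hnn : ∀ z, 0 ≤ (ball (0 : Rn n) 3)ᶜ.indicator (fun _ => -m) z := fun z =>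
    Set.indicator_nonneg (fun _ _ => by linarith) _
  have e : secondDiff (barrier m ψ) x y = secondDiff ψ x y +
      ((ball (0 : Rn n) 3)ᶜ.indicator (fun _ => -m) (x + y) +
        (ball (0 : Rn n) 3)ᶜ.indicator (fun _ => -m) (x - y)) := by
    simp only [secondDiff, barrier, hx0]; ring
  rw [e]
  have h2 : 2 * (-m) * (Set.Ici (6 : ℝ)).indicator (fun _ => (1 : ℝ)) ‖y‖ ≤
      (ball (0 : Rn n) 3)ᶜ.indicator (fun _ => -m) (x + y) +
        (ball (0 : Rn n) 3)ᶜ.indicator (fun _ => -m) (x - y) := by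
    by_cases hy : 6 ≤ ‖y‖
    · have a1 : x + y ∈ (ball (0 : Rn n) 3)ᶜ := by
        have := norm_sub_le (x + y) x
        simp only [add_sub_cancel_left] at this
        simp only [Set.mem_compl_iff, mem_ball_zero_iff, not_lt]
        linarith
      have a2 : x - y ∈ (ball (0 : Rn n) 3)ᶜ := by
        have := norm_sub_le x (x - y)
        simp only [sub_sub_cancel] at this
        simp only [Set.mem_compl_iff, mem_ball_zero_iff, not_lt]
        linarith
      rw [Set.indicator_of_mem (by exact hy), Set.indicator_of_mem a1, Set.indicator_of_mem a2]
      linarith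
    · rw [Set.indicator_of_notMem (by exact hy)]
      have := hnn (x + y)
      have := hnn (x - y)
      linarith
  linarith

/-- Splicing in a test function from above only raises the second difference at the contact point,
so the barrier's own radial lower bound applies. Integrated against a rank-one kernel, a radial
function gives the same value for every direction, and `hc` makes it nonnegative. -/
lemma viscSubsol_barrier (hn : 2 ≤ n) (hσ : 0 < σ) (hσ2 : σ < 2) {m : ℝ} (hm : m ≤ 0)
    {ψ : Rn n → ℝ} (hψc : Continuous ψ) {c M : ℝ} (hM : ∀ z, |barrier m ψ z| ≤ M)
    (hψ : ∀ x, QuadBound c (secondDiff ψ x))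
    (hc : c * (∫ y : Rn n, min (‖y‖ ^ 2) 1 * ‖y‖ ^ (-(n : ℝ) - σ)) ≤ 2 * (-m) * farMass n σ 6) :
    ViscSubsol (firstEig σ) (ball 0 3) (barrier m ψ) := by
  intro x hx r hr _ φ hφ hφx hle
  have hvm : Measurable (barrier m ψ) := (upperSemicontinuous_barrier hm hψc).measurable
  obtain ⟨C, hC⟩ := exists_quadBound_splice hφ hM x hr
  have hmeas := measurable_secondDiff (measurable_splice hφ.continuous.measurable hvm x r) x
  refine firstEig_nonneg hn hσ hσ2 hC hmeas fun τ => ?_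
  set h : ℝ → ℝ := fun s => -c * min (s ^ 2) 1 +
    2 * (-m) * (Set.Ici (6 : ℝ)).indicator (fun _ => (1 : ℝ)) s with hh
  have hhm : Measurable h := by
    refine Measurable.add (by fun_prop) (Measurable.const_mul ?_ _)
    exact measurable_const.indicator measurableSet_Ici
  have i1 := (integrable_min_weight (n := n) hn hσ hσ2).const_mul (-c)
  have i2 := (integrable_far_weight (n := n) hn hσ hσ2 (R := 6) (by norm_num)).const_mul (2 * (-m))
  have e : ∀ y : Rn n, h ‖y‖ * ‖y‖ ^ (-(n : ℝ) - σ) =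
      -c * (min (‖y‖ ^ 2) 1 * ‖y‖ ^ (-(n : ℝ) - σ)) +
      2 * (-m) * ((Set.Ici (6 : ℝ)).indicator (fun _ => (1 : ℝ)) ‖y‖ * ‖y‖ ^ (-(n : ℝ) - σ)) :=
    fun y => by simp only [hh]; ring
  have hi : Integrable fun y : Rn n => h ‖y‖ * ‖y‖ ^ (-(n : ℝ) - σ) :=
    (i1.add i2).congr (Filter.Eventually.of_forall fun y => (e y).symm)
  have hval := integral_radial_quadKernel hσ (rankOne τ.1) hhm hi
  have hge : 0 ≤ ∫ y : Rn n, h ‖y‖ * quadKernel σ (rankOne τ.1) y := by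
    rw [hval, rankOne_trace]
    refine mul_nonneg (by positivity) ?_
    simp only [e]
    rw [integral_add i1 i2, integral_const_mul, integral_const_mul]
    unfold farMass at hc
    linarith
  refine hge.trans (integral_mono (integrable_radial_quadKernel hσ _ hhm hi)
    (hC.integrable hn hσ hσ2 hmeas _) fun y => ?_)
  refine mul_le_mul_of_nonneg_right ?_ (quadKernel_nonneg (rankOne_posSemidef _) y)
  refine (barrier_secondDiff_ge hm (hψ x) hx y).trans ?_
  have hsp : ∀ z, barrier m ψ z ≤ splice φ (barrier m ψ) x r z := by
    intro z
    unfold splice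
    split_ifs with hz
    · exact hle z hz
    · exact le_rfl
  have h1 := hsp (x + y)
  have h2 := hsp (x - y)
  have h3 : splice φ (barrier m ψ) x r x = barrier m ψ x := by rw [splice_self hr, hφx]
  unfold secondDiff
  rw [h3]
  linarith

end Barrier

/-! ### The obstacle, and where the envelope can reach its minimum -/

section Envelope
variable {n : ℕ} {σ : ℝ} {u : Rn n → ℝ}

/-- The obstacle `u 1_{B_1}`. -/
noncomputable def obstacle (u : Rn n → ℝ) : Rn n → ℝ := (ball (0 : Rn n) 1).indicator u

lemma obstacle_of_notMem {x : Rn n} (hx : x ∉ ball (0 : Rn n) 1) : obstacle u x = 0 :=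
  Set.indicator_of_notMem hx _

lemma obstacle_eq_min (h1 : ∀ x ∈ ball (0 : Rn n) 1, u x ≤ 0)
    (h2 : ∀ x ∉ ball (0 : Rn n) 1, 0 ≤ u x) (x : Rn n) : obstacle u x = min (u x) 0 := by
  by_cases hx : x ∈ ball (0 : Rn n) 1
  · rw [obstacle, Set.indicator_of_mem hx, min_eq_left (h1 x hx)]
  · rw [obstacle_of_notMem hx, min_eq_right (h2 x hx)]

lemma lowerSemicontinuous_obstacle (hu : LowerSemicontinuous u)
    (h1 : ∀ x ∈ ball (0 : Rn n) 1, u x ≤ 0) (h2 : ∀ x ∉ ball (0 : Rn n) 1, 0 ≤ u x) :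
    LowerSemicontinuous (obstacle u) := by
  have : obstacle u = fun x => min (u x) 0 := funext (obstacle_eq_min h1 h2)
  rw [this]
  exact hu.inf continuous_const.lowerSemicontinuous

lemma exists_obstacle_min (hq : LowerSemicontinuous (obstacle u)) (h0 : ∀ x, obstacle u x ≤ 0) :
    ∃ z, ∀ x, obstacle u z ≤ obstacle u x := by
  obtain ⟨z, -, hz⟩ := (hq.lowerSemicontinuousOn (closedBall (0 : Rn n) 1)).exists_isMinOn
    ⟨0, by simp⟩ (isCompact_closedBall _ _)
  refine ⟨z, fun x => ?_⟩
  by_cases hx : x ∈ closedBall (0 : Rn n) 1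
  · exact hz hx
  · rw [obstacle_of_notMem (fun h => hx (ball_subset_closedBall h))]
    exact h0 z

lemma bddAbove_envelopeClass (x : Rn n) :
    BddAbove ((fun v : Rn n → ℝ => v x) '' envelopeClass σ u) := by
  refine ⟨obstacle u x, ?_⟩
  rintro _ ⟨v, hv, rfl⟩
  exact hv.2.2.2 x

lemma le_envelope {v : Rn n → ℝ} (hv : v ∈ envelopeClass σ u) (x : Rn n) :
    v x ≤ envelope σ u x :=
  le_csSup (bddAbove_envelopeClass x) ⟨v, hv, rfl⟩

lemma envelope_le (hne : (envelopeClass σ u).Nonempty) (x : Rn n) :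
    envelope σ u x ≤ obstacle u x := by
  refine csSup_le (hne.image _) ?_
  rintro _ ⟨v, hv, rfl⟩
  exact hv.2.2.2 x

/-- This competitor shows that the supremum defining the envelope is over a nonempty set, and it
yields Γ ≥ m and Γ ≥ 0 off B_3. -/
lemma barrier_zero_mem (hn : 2 ≤ n) (hσ : 0 < σ) (hσ2 : σ < 2) {m : ℝ} (hm : m ≤ 0)
    (hmq : ∀ x, m ≤ obstacle u x) : barrier m (fun _ => 0) ∈ envelopeClass σ u := by
  have hb : ∀ z : Rn n, |barrier m (fun _ => 0) z| ≤ -m := by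
    intro z
    by_cases hz : z ∈ (ball (0 : Rn n) 3)ᶜ
    · simp [barrier, Set.indicator_of_mem hz, hm]
    · simp [barrier, Set.indicator_of_notMem hz, abs_of_nonpos hm]
  refine ⟨upperSemicontinuous_barrier hm continuous_const, ⟨-m, hb⟩, ?_, ?_⟩
  · refine viscSubsol_barrier hn hσ hσ2 hm continuous_const (c := 0) hb ?_ ?_
    · intro x y
      simp [secondDiff]
    · have := farMass_pos (n := n) hn hσ hσ2 (R := 6) (by norm_num)
      have : 0 ≤ 2 * -m * farMass n σ 6 := mul_nonneg (by linarith) this.le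
      linarith
  · intro x
    by_cases hz : x ∈ (ball (0 : Rn n) 3)ᶜ
    · have : obstacle u x = 0 :=
        obstacle_of_notMem fun h => hz (ball_subset_ball (by norm_num) h)
      change _ ≤ obstacle u x
      simp [barrier, Set.indicator_of_mem hz, this]
    · change _ ≤ obstacle u x
      simpa [barrier, Set.indicator_of_notMem hz] using hmq x

/-- Strictly above the minimal level of the obstacle, the envelope lies above that level too. -/
lemma lt_envelope_of_lt_obstacle (hn : 2 ≤ n) (hσ : 0 < σ) (hσ2 : σ < 2) {m : ℝ} (hm : m < 0)
    (hmq : ∀ x, m ≤ obstacle u x) (hq : LowerSemicontinuous (obstacle u)) {x : Rn n}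
    (hx : x ∈ ball (0 : Rn n) 3) (hmx : m < obstacle u x) (h0 : ∀ x, obstacle u x ≤ 0) :
    m < envelope σ u x := by
  obtain ⟨b, hb1, hb2⟩ := exists_between hmx
  have hev : ∀ᶠ z in nhds x, b < obstacle u z ∧ z ∈ ball (0 : Rn n) 3 :=
    (hq x b hb2).and (isOpen_ball.mem_nhds hx)
  obtain ⟨s, hs, hs2⟩ := Metric.eventually_nhds_iff_ball.mp hev
  let η : ContDiffBump x := ⟨s / 2, s, by positivity, by linarith⟩
  have hη : ContDiff ℝ 2 (η : Rn n → ℝ) := η.contDiff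
  obtain ⟨C, hC0, hC⟩ := exists_quadBound_of_hasCompactSupport hη η.hasCompactSupport
  set J := ∫ y : Rn n, min (‖y‖ ^ 2) 1 * ‖y‖ ^ (-(n : ℝ) - σ) with hJ
  have hJ0 : 0 ≤ J := integral_nonneg fun y => by positivity
  have hT := farMass_pos (n := n) hn hσ hσ2 (R := 6) (by norm_num)
  -- The first entry keeps the bump below the obstacle, the second keeps its Hessian contribution
  -- below the gain from the jump; the +1 avoids dividing by zero.
  set ε := min (b - m) (2 * (-m) * farMass n σ 6 / (C * J + 1)) with hε
  have hε0 : 0 < ε := by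
    refine lt_min (by linarith) ?_
    have : 0 < -m := by linarith
    positivity
  have hεb : ε ≤ b - m := min_le_left _ _
  have hη1 : ∀ z, 0 ≤ ε * η z ∧ ε * η z ≤ ε := fun z =>
    ⟨mul_nonneg hε0.le η.nonneg, mul_le_of_le_one_right hε0.le η.le_one⟩
  have hcont : Continuous fun z => ε * η z := continuous_const.mul hη.continuous
  have hbarrier : ∀ z, barrier m (fun z => ε * η z) z ≤ obstacle u z ∧
      m ≤ barrier m (fun z => ε * η z) z := by
    intro z
    have h3 := hη1 z
    by_cases hz : z ∈ (ball (0 : Rn n) 3)ᶜ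
    · have h1 : obstacle u z = 0 :=
        obstacle_of_notMem fun h => hz (ball_subset_ball (by norm_num) h)
      have h2 : η z = 0 := by
        by_contra hne
        have : z ∈ Function.support η := hne
        rw [η.support_eq] at this
        exact hz (hs2 z this).2
      simp only [barrier, Set.indicator_of_mem hz, h1, h2]
      constructor <;> linarith
    · simp only [barrier, Set.indicator_of_notMem hz]
      refine ⟨?_, by linarith⟩
      by_cases hzs : z ∈ ball x s
      · have := (hs2 z hzs).1
        linarith
      · have h2 : η z = 0 := by
          by_contra hne
          have : z ∈ Function.support η := hne
          rw [η.support_eq] at this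
          exact hzs this
        have := hmq z
        rw [h2]; linarith
  have hbd : ∀ z, |barrier m (fun z => ε * η z) z| ≤ -m := by
    intro z
    have h1 := hbarrier z
    have h2 := h0 z
    rw [abs_le]
    constructor <;> linarith
  have hmem : barrier m (fun z => ε * η z) ∈ envelopeClass σ u := by
    refine ⟨upperSemicontinuous_barrier hm.le hcont, ⟨_, hbd⟩, ?_, fun z => (hbarrier z).1⟩
    refine viscSubsol_barrier hn hσ hσ2 hm.le hcont (c := ε * C) hbd ?_ ?_
    · intro z y
      have : secondDiff (fun z => ε * η z) z y = ε * secondDiff η z y := by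
        simp only [secondDiff]; ring
      rw [this, abs_mul, abs_of_pos hε0, mul_assoc]
      exact mul_le_mul_of_nonneg_left (hC z y) hε0.le
    · have h1 : ε ≤ 2 * (-m) * farMass n σ 6 / (C * J + 1) := min_le_right _ _
      rw [le_div_iff₀ (by positivity)] at h1
      nlinarith
  refine lt_of_lt_of_le ?_ (le_envelope hmem x)
  have h1 : η x = 1 := η.one_of_mem_closedBall (mem_closedBall_self η.rIn_pos.le)
  have h2 : x ∉ (ball (0 : Rn n) 3)ᶜ := fun h => h hx
  simp only [barrier, Set.indicator_of_notMem h2, h1]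
  linarith

end Envelope
-- Lebesgue density and the paraboloid test
section Density
variable {n : ℕ} {σ : ℝ}

/-- A union of measurable sets is null measurable as soon as none of them has density zero at any
of its relevant points. -/
lemma nullMeasurableSet_of_forall_density (S : Set (Rn n))
    (h : ∀ x ∈ S, ∃ E ⊆ S, MeasurableSet E ∧
      ¬ Filter.Tendsto (fun r => volume (E ∩ closedBall x r) / volume (closedBall x r))
        (nhdsWithin 0 (Set.Ioi 0)) (nhds 0)) :
    NullMeasurableSet S := by
  -- S differs from the measurable set Tᶜ by S ∩ T only. A measurable E ⊆ S meets T in a null set,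
  -- because the measurable hull T has the same measure as Sᶜ inside E; so where Tᶜ has density
  -- zero, E has too.
  set T := toMeasurable volume Sᶜ with hT
  have hTm : MeasurableSet T := measurableSet_toMeasurable _ _
  have hST : Sᶜ ⊆ T := subset_toMeasurable _ _
  have hnull : volume (S ∩ T) = 0 := by
    have hae := Besicovitch.ae_tendsto_measure_inter_div_of_measurableSet
      (volume : Measure (Rn n)) hTm.compl
    rw [← compl_mem_ae_iff]
    filter_upwards [hae] with x hx hxST
    obtain ⟨E, hES, hE, hnot⟩ := h x hxST.1
    refine hnot ?_
    rw [Set.indicator_of_notMem (Set.notMem_compl_iff.mpr hxST.2)] at hx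
    refine tendsto_of_tendsto_of_tendsto_of_le_of_le tendsto_const_nhds hx
      (fun _ => zero_le) fun r => ?_
    refine ENNReal.div_le_div_right ?_ _
    have h0 : volume (T ∩ E) = 0 := by
      rw [hT, Measure.measure_toMeasurable_inter_of_sFinite hE,
        (Set.disjoint_compl_left_iff_subset.mpr hES).inter_eq, measure_empty]
    calc volume (E ∩ closedBall x r) ≤ volume ((Tᶜ ∩ closedBall x r) ∪ (T ∩ E)) := by
          refine measure_mono fun y hy => ?_
          by_cases hyT : y ∈ T
          · exact Or.inr ⟨hyT, hy.1⟩
          · exact Or.inl ⟨hyT, hy.2⟩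
      _ ≤ volume (Tᶜ ∩ closedBall x r) + volume (T ∩ E) := measure_union_le _ _
      _ = _ := by rw [h0, add_zero]
  have hS : S = Tᶜ ∪ (S ∩ T) := by
    ext y
    by_cases hyT : y ∈ T
    · simp [hyT]
    · have : y ∈ S := by_contra fun hc => hyT (hST hc)
      simp [hyT, this]
  rw [hS]
  exact hTm.compl.nullMeasurableSet.union (NullMeasurableSet.of_null hnull)

/-- The substitution y ↦ Ry; it makes all terms of the paraboloid test scale like r^(-σ). -/
lemma farMass_eq {R : ℝ} (hR : 0 < R) : farMass n σ R = R ^ (-σ) * farMass n σ 1 := by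
  have h := Measure.integral_comp_smul (volume : Measure (Rn n)) (fun y : Rn n =>
    (Set.Ici R).indicator (fun _ => (1 : ℝ)) ‖y‖ * ‖y‖ ^ (-(n : ℝ) - σ)) R
  have e : ∀ y : Rn n, (Set.Ici R).indicator (fun _ => (1 : ℝ)) ‖R • y‖ *
      ‖R • y‖ ^ (-(n : ℝ) - σ) = R ^ (-(n : ℝ) - σ) *
      ((Set.Ici 1).indicator (fun _ => (1 : ℝ)) ‖y‖ * ‖y‖ ^ (-(n : ℝ) - σ)) := by
    intro y
    rw [norm_smul, Real.norm_of_nonneg hR.le, Real.mul_rpow hR.le (norm_nonneg _)]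
    have : (Set.Ici R).indicator (fun _ => (1 : ℝ)) (R * ‖y‖) =
        (Set.Ici 1).indicator (fun _ => (1 : ℝ)) ‖y‖ := by
      simp only [Set.indicator, Set.mem_Ici, le_mul_iff_one_le_right hR]
    rw [this]; ring
  simp only [e] at h
  rw [integral_const_mul] at h
  have hRn : 0 < R ^ n := pow_pos hR n
  simp only [finrank_euclideanSpace, Fintype.card_fin, abs_of_pos (inv_pos.mpr hRn),
    smul_eq_mul] at h
  have h2 : R ^ (-(n : ℝ) - σ) = (R ^ n)⁻¹ * R ^ (-σ) := by
    rw [sub_eq_add_neg, Real.rpow_add hR, Real.rpow_neg hR.le, Real.rpow_natCast]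
  rw [h2, mul_assoc] at h
  exact (mul_left_cancel₀ (inv_pos.mpr hRn).ne' h).symm

lemma integral_far_quadKernel (hn : 2 ≤ n) (hσ : 0 < σ) (hσ2 : σ < 2) {R : ℝ} (hR : 0 < R)
    (τ : sphere (0 : Rn n) 1) :
    Integrable (fun y : Rn n => (Set.Ici R).indicator (fun _ => (1 : ℝ)) ‖y‖ *
      quadKernel σ (rankOne τ.1) y) ∧
    ∫ y : Rn n, (Set.Ici R).indicator (fun _ => (1 : ℝ)) ‖y‖ * quadKernel σ (rankOne τ.1) y =
      R ^ (-σ) * farMass n σ 1 / n := by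
  have hm : Measurable ((Set.Ici R).indicator (fun _ => (1 : ℝ))) :=
    measurable_const.indicator measurableSet_Ici
  have hi := integrable_far_weight (n := n) hn hσ hσ2 hR
  refine ⟨integrable_radial_quadKernel hσ _ hm hi, ?_⟩
  rw [integral_radial_quadKernel hσ _ hm hi, rankOne_trace, ← farMass_eq hR, farMass]
  ring

lemma integral_truncated_quadKernel (hn : 2 ≤ n) (hσ : 0 < σ) (hσ2 : σ < 2) {R : ℝ} (hR : 0 < R)
    (A : Matrix (Fin n) (Fin n) ℝ) :
    Integrable (fun y : Rn n => min (‖y‖ ^ 2) (R ^ 2) * quadKernel σ A y) ∧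
    ∫ y : Rn n, min (‖y‖ ^ 2) (R ^ 2) * quadKernel σ A y =
      A.trace * (volume.real (ball (0 : Rn n) 1) * (R ^ (2 - σ) * (2 / (σ * (2 - σ))))) := by
  have hm : Measurable fun s : ℝ => min (s ^ 2) (R ^ 2) := by fun_prop
  obtain ⟨hi, hv⟩ := integral_truncated_weight (n := n) hn hσ hσ2 hR
  refine ⟨integrable_radial_quadKernel hσ A hm hi, ?_⟩
  rw [integral_radial_quadKernel hσ A hm hi, hv]
  have : (n : ℝ) ≠ 0 := by positivity
  field_simp

/-- The integral inequality obtained by testing a subsolution with a paraboloid at scale `r`. -/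
lemma paraboloid_test (hn : 2 ≤ n) (hσ : 0 < σ) (hσ2 : σ < 2) {v : Rn n → ℝ}
    (hv : Measurable v) {M : ℝ} (hM : ∀ x, |v x| ≤ M)
    (hsub : ViscSubsol (firstEig σ) (ball 0 3) v) {x a : Rn n} {c d q r T : ℝ} (hr : 0 < r)
    (hT : 1 ≤ T) (hq : 0 ≤ q) (hd : 0 ≤ d) (ha : dist a x ≤ r) (hball : ball a r ⊆ ball 0 3)
    (hva : c + d ≤ v a)
    (htouch : ∀ z ∈ ball a r, v z ≤ v a + q / r ^ 2 * (‖z - x‖ ^ 2 - ‖a - x‖ ^ 2)) :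
    0 ≤ 2 * q * (volume.real (ball (0 : Rn n) 1) * (2 / (σ * (2 - σ)))) -
      2 * d * (farMass n σ 1 / n) + (4 * M + 2 * d) * (T ^ (-σ) * (farMass n σ 1 / n)) +
      (4 * M + 2 * d) * (2 * volume.real ({z | c < v z} ∩ closedBall x (r * (T + 1))) / r ^ n) := by
  have : NeZero n := ⟨by omega⟩
  have hM0 : 0 ≤ M := (abs_nonneg _).trans (hM 0)
  obtain ⟨τ⟩ : Nonempty (sphere (0 : Rn n) 1) := by
    obtain ⟨y, hy⟩ := exists_norm_eq (Rn n) (zero_le_one (α := ℝ))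
    exact ⟨⟨y, by simpa using hy⟩⟩
  set φ : Rn n → ℝ := fun z => v a + q / r ^ 2 * (‖z - x‖ ^ 2 - ‖a - x‖ ^ 2) with hφdef
  have hφ : ContDiff ℝ 2 φ := by
    have h1 : ContDiff ℝ 2 fun z : Rn n => ‖z - x‖ ^ 2 :=
      (contDiff_id.sub contDiff_const).norm_sq ℝ
    exact contDiff_const.add (contDiff_const.mul (h1.sub contDiff_const))
  have hφa : φ a = v a := by simp [hφdef]
  have ha3 : a ∈ ball (0 : Rn n) 3 := hball (mem_ball_self hr)
  have hE := hsub a ha3 r hr hball φ hφ hφa htouch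
  obtain ⟨C, hC⟩ := exists_quadBound_splice hφ hM a hr
  have hmeas := measurable_secondDiff (measurable_splice hφ.continuous.measurable hv a r) a
  have h0 := integral_nonneg_of_firstEig hn hσ hσ2 hC hmeas hE τ
  set k := quadKernel σ (rankOne τ.1) with hk
  have hk0 : ∀ y, 0 ≤ k y := quadKernel_nonneg (rankOne_posSemidef _)
  set S := {z | c < v z} ∩ closedBall x (r * (T + 1)) with hS
  have hSm : MeasurableSet S := (measurableSet_lt measurable_const hv).inter measurableSet_closedBall
  have hSfin : volume S < ⊤ :=
    (measure_mono Set.inter_subset_right).trans_lt measure_closedBall_lt_top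
  have mp1 : MeasurePreserving (fun y : Rn n => a + y) volume volume :=
    measurePreserving_add_left volume a
  have mp2 : MeasurePreserving (fun y : Rn n => a - y) volume volume :=
    Measure.measurePreserving_sub_left volume a
  -- The increments for which a + y or a - y falls in the superlevel set; elsewhere in r ≤ |y| < rT
  -- both values are at most c.
  set B : Set (Rn n) := (fun y => a + y) ⁻¹' S ∪ (fun y => a - y) ⁻¹' S with hB
  have hBm : MeasurableSet B := (mp1.measurable hSm).union (mp2.measurable hSm)
  have hBle : volume B ≤ 2 * volume S := by
    refine (measure_union_le _ _).trans ?_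
    rw [mp1.measure_preimage hSm.nullMeasurableSet, mp2.measure_preimage hSm.nullMeasurableSet,
      two_mul]
  have hBfin : volume B < ⊤ := hBle.trans_lt (ENNReal.mul_lt_top (by norm_num) hSfin)
  have hBreal : volume.real B ≤ 2 * volume.real S := by
    have := ENNReal.toReal_mono (ENNReal.mul_lt_top (by norm_num) hSfin).ne hBle
    simpa [Measure.real] using this
  obtain ⟨i1, e1⟩ := integral_truncated_quadKernel hn hσ hσ2 hr (rankOne τ.1)
  obtain ⟨i2, e2⟩ := integral_far_quadKernel hn hσ hσ2 hr τ
  obtain ⟨i3, e3⟩ := integral_far_quadKernel hn hσ hσ2 (mul_pos hr (by linarith : 0 < T)) τ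
  have i4 : Integrable (B.indicator fun _ : Rn n => r ^ (-(n : ℝ) - σ)) :=
    (integrable_indicator_iff hBm).mpr (integrableOn_const hBfin.ne)
  have e4 : ∫ y, B.indicator (fun _ : Rn n => r ^ (-(n : ℝ) - σ)) y =
      volume.real B * r ^ (-(n : ℝ) - σ) := by
    rw [integral_indicator hBm, setIntegral_const, smul_eq_mul]
  rw [← hk] at i1 e1 i2 e2 i3 e3
  -- The gain -2d is charged on all of |y| ≥ r. Where it may fail, far away or on B, the second
  -- difference is only at most 4M, so 4M + 2d is added back there.
  have hpt : ∀ y, secondDiff (splice φ v a r) a y * k y ≤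
      2 * (q / r ^ 2) * (min (‖y‖ ^ 2) (r ^ 2) * k y) +
      (-(2 * d)) * ((Set.Ici r).indicator (fun _ => (1 : ℝ)) ‖y‖ * k y) +
      (4 * M + 2 * d) * ((Set.Ici (r * T)).indicator (fun _ => (1 : ℝ)) ‖y‖ * k y) +
      (4 * M + 2 * d) * B.indicator (fun _ : Rn n => r ^ (-(n : ℝ) - σ)) y := by
    intro y
    have hky := hk0 y
    have hB0 : 0 ≤ B.indicator (fun _ : Rn n => r ^ (-(n : ℝ) - σ)) y :=
      Set.indicator_nonneg (fun _ _ => by positivity) _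
    have hMd : 0 ≤ 4 * M + 2 * d := by positivity
    have hfar0 : 0 ≤ (Set.Ici (r * T)).indicator (fun _ => (1 : ℝ)) ‖y‖ :=
      Set.indicator_nonneg (fun _ _ => zero_le_one) _
    rcases lt_or_ge ‖y‖ r with hy | hy
    · rw [secondDiff_splice_of_lt hy, Set.indicator_of_notMem (s := Set.Ici r) (by simpa using hy)]
      have e : secondDiff φ a y = 2 * (q / r ^ 2) * ‖y‖ ^ 2 := by
        have ea : a + y - x = (a - x) + y := by abel
        have eb : a - y - x = (a - x) - y := by abel
        simp only [secondDiff, hφdef]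
        rw [ea, eb, norm_add_sq_real (a - x) y, norm_sub_sq_real (a - x) y]
        ring
      rw [e, min_eq_left (by gcongr)]
      have := mul_nonneg hMd hB0
      have := mul_nonneg hMd (mul_nonneg hfar0 hky)
      linarith
    · rw [secondDiff_splice_of_le hr hy, hφa,
        Set.indicator_of_mem (s := Set.Ici r) (by exact hy), one_mul]
      have hmin : 0 ≤ 2 * (q / r ^ 2) * (min (‖y‖ ^ 2) (r ^ 2) * k y) := by positivity
      have b1 := (abs_le.mp (hM (a + y))).2
      have b2 := (abs_le.mp (hM (a - y))).2
      have b3 := (abs_le.mp (hM a)).1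
      have hup : v (a + y) + v (a - y) - 2 * v a ≤ 4 * M := by linarith
      have hup2 := mul_le_mul_of_nonneg_right hup hky
      by_cases hyT : r * T ≤ ‖y‖
      · rw [Set.indicator_of_mem (s := Set.Ici (r * T)) (by exact hyT), one_mul]
        have := mul_nonneg hMd hB0
        linarith
      · rw [Set.indicator_of_notMem (s := Set.Ici (r * T)) (by exact hyT)]
        push Not at hyT
        by_cases hyB : y ∈ B
        · rw [Set.indicator_of_mem hyB]
          have hkr : k y ≤ r ^ (-(n : ℝ) - σ) := by
            have h1 := quadKernel_le hσ (rankOne_posSemidef τ.1) y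
            rw [rankOne_trace, one_mul] at h1
            refine h1.trans (Real.rpow_le_rpow_of_nonpos hr hy ?_)
            have : (0 : ℝ) ≤ n := n.cast_nonneg
            linarith
          have := mul_le_mul_of_nonneg_left hkr hMd
          linarith
        · rw [Set.indicator_of_notMem hyB]
          simp only [hB, hS, Set.mem_union, Set.mem_preimage, Set.mem_inter_iff, Set.mem_ofPred_eq,
            not_or, not_and_or, not_lt, mem_closedBall] at hyB
          have hax : ‖a - x‖ ≤ r := by rwa [← dist_eq_norm]
          have c1 : dist (a + y) x ≤ r * (T + 1) := by
            rw [dist_eq_norm]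
            have := norm_add_le (a - x) y
            have e : a + y - x = (a - x) + y := by abel
            rw [e]; linarith
          have c2 : dist (a - y) x ≤ r * (T + 1) := by
            rw [dist_eq_norm]
            have := norm_sub_le (a - x) y
            have e : a - y - x = (a - x) - y := by abel
            rw [e]; linarith
          have g1 : v (a + y) ≤ c := hyB.1.resolve_right fun h => h c1
          have g2 : v (a - y) ≤ c := hyB.2.resolve_right fun h => h c2
          have : v (a + y) + v (a - y) - 2 * v a ≤ -(2 * d) := by linarith
          have := mul_le_mul_of_nonneg_right this hky
          linarith
  have h1 := h0.trans (integral_mono (hC.integrable hn hσ hσ2 hmeas _)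
    ((((i1.const_mul _).add (i2.const_mul _)).add (i3.const_mul _)).add (i4.const_mul _)) hpt)
  rw [integral_add' (((i1.const_mul _).add (i2.const_mul _)).add (i3.const_mul _)) (i4.const_mul _),
    integral_add' ((i1.const_mul _).add (i2.const_mul _)) (i3.const_mul _),
    integral_add' (i1.const_mul _) (i2.const_mul _), integral_const_mul, integral_const_mul,
    integral_const_mul, integral_const_mul, e1, e2, e3, e4, rankOne_trace] at h1
  have p1 : r ^ (2 - σ) = r ^ 2 * r ^ (-σ) := by
    rw [sub_eq_add_neg, Real.rpow_add hr, Real.rpow_ofNat]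
  have p2 : (r * T) ^ (-σ) = r ^ (-σ) * T ^ (-σ) := Real.mul_rpow hr.le (by linarith)
  have p3 : r ^ (-(n : ℝ) - σ) = (r ^ n)⁻¹ * r ^ (-σ) := by
    rw [sub_eq_add_neg, Real.rpow_add hr, Real.rpow_neg hr.le, Real.rpow_natCast]
  have hrσ : 0 < r ^ (-σ) := Real.rpow_pos_of_pos hr _
  rw [p1, p2, p3] at h1
  have h2 : 0 ≤ r ^ (-σ) * (2 * q * (volume.real (ball (0 : Rn n) 1) * (2 / (σ * (2 - σ)))) -
      2 * d * (farMass n σ 1 / n) + (4 * M + 2 * d) * (T ^ (-σ) * (farMass n σ 1 / n)) +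
      (4 * M + 2 * d) * (volume.real B / r ^ n)) := by
    refine h1.trans_eq ?_
    have : r ≠ 0 := hr.ne'
    field_simp
    ring
  have h3 := nonneg_of_mul_nonneg_right h2 hrσ
  have h4 : (4 * M + 2 * d) * (volume.real B / r ^ n) ≤
      (4 * M + 2 * d) * (2 * volume.real S / r ^ n) := by gcongr
  linarith

end Density
-- Non-vanishing density of superlevel sets and measurability of the envelope
section Measurability
variable {n : ℕ} {σ : ℝ}

/-- Take a maximizing v(z) - (q/r²)|z - x|² over a fixed closed ball. Boundedness of v forces a
close to x for small r; then upper semicontinuity gives v(a) < v(x) + q, which improves this to |a -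
x| < r. -/
lemma exists_paraboloid_touching {v : Rn n → ℝ} (hv : UpperSemicontinuous v) {M : ℝ}
    (hM : ∀ x, |v x| ≤ M) {x : Rn n} {R q : ℝ} (hR : 0 < R) (hq : 0 < q) :
    ∀ᶠ r in nhdsWithin (0 : ℝ) (Set.Ioi 0), ∃ a, dist a x ≤ r ∧ ball a r ⊆ closedBall x R ∧
      v x ≤ v a ∧ ∀ z ∈ ball a r, v z ≤ v a + q / r ^ 2 * (‖z - x‖ ^ 2 - ‖a - x‖ ^ 2) := by
  obtain ⟨δ, hδ, hδv⟩ := Metric.eventually_nhds_iff_ball.mp (hv x (v x + q) (by linarith))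
  have ev1 : ∀ᶠ r in nhdsWithin (0 : ℝ) (Set.Ioi 0), 2 * r < R := by
    have : Filter.Tendsto (fun r : ℝ => 2 * r) (nhds 0) (nhds (2 * 0)) :=
      (continuous_const.mul continuous_id).tendsto 0
    rw [mul_zero] at this
    exact (this.mono_left nhdsWithin_le_nhds).eventually_lt_const hR
  have ev2 : ∀ᶠ r in nhdsWithin (0 : ℝ) (Set.Ioi 0), 2 * M / q * r ^ 2 < δ ^ 2 := by
    have : Filter.Tendsto (fun r : ℝ => 2 * M / q * r ^ 2) (nhds 0) (nhds (2 * M / q * 0 ^ 2)) :=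
      Continuous.tendsto (by fun_prop) 0
    simp only [ne_eq, OfNat.ofNat_ne_zero, not_false_eq_true, zero_pow, mul_zero] at this
    exact (this.mono_left nhdsWithin_le_nhds).eventually_lt_const (by positivity)
  filter_upwards [ev1, ev2, self_mem_nhdsWithin] with r h1 h2 hr
  have hr : 0 < r := hr
  have husc : UpperSemicontinuous fun z => v z + -(q / r ^ 2 * ‖z - x‖ ^ 2) :=
    hv.add (Continuous.upperSemicontinuous (by fun_prop))
  obtain ⟨a, haR, ha⟩ := (husc.upperSemicontinuousOn (closedBall x R)).exists_isMaxOn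
    ⟨x, mem_closedBall_self hR.le⟩ (isCompact_closedBall x R)
  have hax := ha (mem_closedBall_self hR.le)
  simp only [Set.mem_ofPred_eq, sub_self, norm_zero] at hax
  have hax2 : q / r ^ 2 * ‖a - x‖ ^ 2 ≤ v a - v x := by
    linarith [hax, show q / r ^ 2 * (0 : ℝ) ^ 2 = 0 by ring]
  have hnn : 0 ≤ q / r ^ 2 * ‖a - x‖ ^ 2 := by positivity
  have hqr : q / r ^ 2 * ‖a - x‖ ^ 2 = q * (‖a - x‖ ^ 2 / r ^ 2) := by ring
  have hclose : ‖a - x‖ < δ := by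
    have h3 : v a - v x ≤ 2 * M := by linarith [(abs_le.mp (hM a)).2, (abs_le.mp (hM x)).1]
    have h4 : q * (‖a - x‖ ^ 2 / r ^ 2) ≤ 2 * M := by linarith
    rw [← le_div_iff₀' hq, div_le_iff₀ (by positivity)] at h4
    exact lt_of_pow_lt_pow_left₀ 2 hδ.le (by linarith)
  have hva := hδv a (by rwa [mem_ball, dist_eq_norm])
  have hle : ‖a - x‖ < r := by
    have h4 : q * (‖a - x‖ ^ 2 / r ^ 2) < q * 1 := by linarith
    have h5 := lt_of_mul_lt_mul_left h4 hq.le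
    rw [div_lt_one (by positivity)] at h5
    exact lt_of_pow_lt_pow_left₀ 2 hr.le h5
  refine ⟨a, by rw [dist_eq_norm]; exact hle.le, fun z hz => ?_, by linarith, ?_⟩
  · rw [mem_closedBall]
    have := dist_triangle z a x
    rw [dist_eq_norm a x] at this
    have := mem_ball.mp hz
    linarith
  · intro z hz
    have hzR : z ∈ closedBall x R := by
      rw [mem_closedBall]
      have := dist_triangle z a x
      rw [dist_eq_norm a x] at this
      have := mem_ball.mp hz
      linarith
    have := ha hzR
    simp only [Set.mem_ofPred_eq] at this
    linarith

/-- Superlevel sets of a bounded subsolution do not have density zero at their own points. -/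
lemma ViscSubsol.not_tendsto_density (hn : 2 ≤ n) (hσ : 0 < σ) (hσ2 : σ < 2) {v : Rn n → ℝ}
    (hv : UpperSemicontinuous v) {M : ℝ} (hM : ∀ x, |v x| ≤ M)
    (hsub : ViscSubsol (firstEig σ) (ball 0 3) v) {x : Rn n} (hx : x ∈ ball (0 : Rn n) 3) {c : ℝ}
    (hc : c < v x) :
    ¬ Filter.Tendsto
      (fun r => volume ({z | c < v z} ∩ closedBall x r) / volume (closedBall x r))
        (nhdsWithin 0 (Set.Ioi 0)) (nhds 0) := by
  intro hlim
  have : NeZero n := ⟨by omega⟩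
  have hM0 : 0 ≤ M := (abs_nonneg _).trans (hM 0)
  obtain ⟨d, hd, hcd⟩ : ∃ d, 0 < d ∧ c + d = v x := ⟨v x - c, by linarith, by ring⟩
  obtain ⟨R, hR, hRs⟩ := nhds_basis_closedBall.mem_iff.mp (isOpen_ball.mem_nhds hx)
  set ω := volume.real (ball (0 : Rn n) 1) with hω
  have hω0 : 0 < ω := by
    rw [hω, Measure.real]
    exact ENNReal.toReal_pos (measure_ball_pos volume _ one_pos).ne' measure_ball_lt_top.ne
  set J := ω * (2 / (σ * (2 - σ))) with hJ
  have hJ0 : 0 < J := by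
    have : 0 < 2 - σ := by linarith
    positivity
  set G := farMass n σ 1 / n with hG
  have hG0 : 0 < G := div_pos (farMass_pos hn hσ hσ2 one_pos) (by positivity)
  set K := 4 * M + 2 * d with hK
  have hK0 : 0 < K := by positivity
  -- T, q and ε are chosen so that each of the three error terms in `paraboloid_test` is at most
  -- dG/2; together they cannot balance the gain 2dG.
  obtain ⟨T, hT1, hT⟩ : ∃ T : ℝ, 1 ≤ T ∧ K * T ^ (-σ) ≤ d / 2 := by
    have h1 := (tendsto_rpow_neg_atTop hσ).const_mul K
    rw [mul_zero] at h1
    obtain ⟨T, h2, h3⟩ :=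
      ((h1.eventually_le_const (by positivity : 0 < d / 2)).and (Filter.eventually_ge_atTop 1)).exists
    exact ⟨T, h3, h2⟩
  set q := d * G / (4 * J) with hq
  have hq0 : 0 < q := by positivity
  set ε := d * G / (4 * K * (T + 1) ^ n * ω) with hε
  have hε0 : 0 < ε := by positivity
  have hscale : Filter.Tendsto (fun r : ℝ => r * (T + 1)) (nhdsWithin 0 (Set.Ioi 0))
      (nhdsWithin 0 (Set.Ioi 0)) := by
    refine tendsto_nhdsWithin_of_tendsto_nhds_of_eventually_within _ ?_ ?_
    · have : Filter.Tendsto (fun r : ℝ => r * (T + 1)) (nhds 0) (nhds (0 * (T + 1))) :=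
        Continuous.tendsto (by fun_prop) 0
      rw [zero_mul] at this
      exact this.mono_left nhdsWithin_le_nhds
    · filter_upwards [self_mem_nhdsWithin] with r hr
      have : 0 < r := hr
      exact mul_pos this (by linarith)
  have hev := (hlim.comp hscale).eventually_le_const (ENNReal.ofReal_pos.mpr hε0)
  obtain ⟨r, ⟨hrat, a, ha, hab, hva, htouch⟩, hr⟩ := ((hev.and
    (exists_paraboloid_touching hv hM (x := x) hR hq0)).and self_mem_nhdsWithin).exists
  have hr : 0 < r := hr
  have hkey := paraboloid_test hn hσ hσ2 hv.measurable hM hsub hr hT1 hq0.le hd.le ha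
    (hab.trans hRs) (hcd.le.trans hva) htouch
  have hS : volume.real ({z | c < v z} ∩ closedBall x (r * (T + 1))) / r ^ n ≤
      ε * ((T + 1) ^ n * ω) := by
    have hTr : 0 < r * (T + 1) := by positivity
    have h1 : volume ({z | c < v z} ∩ closedBall x (r * (T + 1))) ≤
        ENNReal.ofReal ε * volume (closedBall x (r * (T + 1))) :=
      (ENNReal.div_le_iff_le_mul (Or.inl (measure_closedBall_pos volume _ hTr).ne')
        (Or.inl measure_closedBall_lt_top.ne)).mp hrat
    have h2 := ENNReal.toReal_mono
      (ENNReal.mul_lt_top ENNReal.ofReal_lt_top measure_closedBall_lt_top).ne h1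
    rw [ENNReal.toReal_mul, ENNReal.toReal_ofReal hε0.le] at h2
    have h3 := Measure.addHaar_real_closedBall (volume : Measure (Rn n)) x hTr.le
    rw [finrank_euclideanSpace, Fintype.card_fin] at h3
    rw [div_le_iff₀ (by positivity)]
    refine h2.trans_eq ?_
    change ε * volume.real (closedBall x (r * (T + 1))) = _
    rw [h3, mul_pow]
    ring
  have e1 : 2 * q * J = d * G / 2 := by rw [hq]; field_simp; norm_num
  have e2 : K * (2 * (ε * ((T + 1) ^ n * ω))) = d * G / 2 := by
    have : T + 1 ≠ 0 := by linarith
    rw [hε]; field_simp; norm_num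
  have e3 : K * (T ^ (-σ) * G) ≤ d / 2 * G := by
    rw [← mul_assoc]; gcongr
  have e4 : K * (2 * volume.real ({z | c < v z} ∩ closedBall x (r * (T + 1))) / r ^ n) ≤
      K * (2 * (ε * ((T + 1) ^ n * ω))) := by
    rw [mul_div_assoc]
    gcongr
  have : 0 < d * G := by positivity
  linarith

variable {u : Rn n → ℝ}

lemma envelope_eq_zero (hn : 2 ≤ n) (hσ : 0 < σ) (hσ2 : σ < 2) {m : ℝ} (hm : m ≤ 0)
    (hmq : ∀ x, m ≤ obstacle u x) {x : Rn n} (hx : x ∉ ball (0 : Rn n) 3) :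
    envelope σ u x = 0 := by
  have hv := barrier_zero_mem (u := u) hn hσ hσ2 hm hmq
  refine le_antisymm ?_ ?_
  · refine (envelope_le ⟨_, hv⟩ x).trans_eq (obstacle_of_notMem fun h => hx ?_)
    exact ball_subset_ball (by norm_num) h
  · refine le_trans ?_ (le_envelope hv x)
    simp [barrier, Set.indicator_of_mem (Set.mem_compl hx)]

lemma le_envelope_of_le_obstacle (hn : 2 ≤ n) (hσ : 0 < σ) (hσ2 : σ < 2) {m : ℝ} (hm : m ≤ 0)
    (hmq : ∀ x, m ≤ obstacle u x) (x : Rn n) : m ≤ envelope σ u x := by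
  refine le_trans ?_ (le_envelope (barrier_zero_mem (u := u) hn hσ hσ2 hm hmq) x)
  have : 0 ≤ (ball (0 : Rn n) 3)ᶜ.indicator (fun _ => -m) x :=
    Set.indicator_nonneg (fun _ _ => by linarith) _
  simp only [barrier]
  linarith

/-- Inside B_3, a superlevel set of Γ is the union of those of the competitors, to which the density
criterion applies; outside, Γ is zero. -/
lemma aemeasurable_envelope (hn : 2 ≤ n) (hσ : 0 < σ) (hσ2 : σ < 2) {m : ℝ} (hm : m ≤ 0)
    (hmq : ∀ x, m ≤ obstacle u x) : AEMeasurable (envelope σ u) := by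
  have hv0 := barrier_zero_mem (u := u) hn hσ hσ2 hm hmq
  suffices h : ∀ c, NullMeasurableSet {x | c < envelope σ u x} volume from
    NullMeasurable.aemeasurable
      (measurable_of_Ioi (δ := NullMeasurableSpace (Rn n) volume) fun c => h c)
  intro c
  have hin : NullMeasurableSet ({x | c < envelope σ u x} ∩ ball (0 : Rn n) 3) volume := by
    refine nullMeasurableSet_of_forall_density _ fun x hx => ?_
    obtain ⟨_, ⟨v, hv, rfl⟩, hcv⟩ := exists_lt_of_lt_csSup (Set.Nonempty.image _ ⟨_, hv0⟩)
      (show c < envelope σ u x from hx.1)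
    obtain ⟨M, hM⟩ := hv.2.1
    refine ⟨{z | c < v z} ∩ ball 0 3, fun z hz => ⟨hz.1.trans_le (le_envelope hv z), hz.2⟩,
      (measurableSet_lt measurable_const hv.1.measurable).inter measurableSet_ball, fun hlim => ?_⟩
    refine ViscSubsol.not_tendsto_density hn hσ hσ2 hv.1 hM hv.2.2.1 hx.2 hcv (hlim.congr' ?_)
    obtain ⟨R, hR, hRs⟩ := nhds_basis_closedBall.mem_iff.mp (isOpen_ball.mem_nhds hx.2)
    filter_upwards [nhdsWithin_le_nhds (gt_mem_nhds hR)] with r hr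
    have : closedBall x r ⊆ ball 0 3 := (closedBall_subset_closedBall hr.le).trans hRs
    rw [Set.inter_assoc, Set.inter_eq_self_of_subset_right this]
  have hout : {x | c < envelope σ u x} ∩ (ball (0 : Rn n) 3)ᶜ = {_x | c < 0} ∩ (ball 0 3)ᶜ := by
    ext x
    constructor
    · rintro ⟨h1, h2⟩
      refine ⟨?_, h2⟩
      have h3 : c < envelope σ u x := h1
      rwa [envelope_eq_zero hn hσ hσ2 hm hmq h2] at h3
    · rintro ⟨h1, h2⟩
      refine ⟨?_, h2⟩
      change c < envelope σ u x
      rwa [envelope_eq_zero hn hσ hσ2 hm hmq h2]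
  have hsplit : {x | c < envelope σ u x} = ({x | c < envelope σ u x} ∩ ball (0 : Rn n) 3) ∪
      ({x | c < envelope σ u x} ∩ (ball (0 : Rn n) 3)ᶜ) := (Set.inter_union_compl _ _).symm
  rw [hsplit, hout]
  exact hin.union ((MeasurableSet.const _).inter measurableSet_ball.compl).nullMeasurableSet

end Measurability
-- Riesz potentials of bounded densities supported in B_3
section Potential
variable {n : ℕ} {σ : ℝ}

lemma norm_rpow_eq (hn : 2 ≤ n) (hσ : 0 < σ) (y : Rn n) :
    ‖y‖ ^ (-(n : ℝ) + (2 - σ)) = ‖y‖ ^ 2 * ‖y‖ ^ (-(n : ℝ) - σ) := by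
  have hn' : (2 : ℝ) ≤ n := by exact_mod_cast hn
  rcases eq_or_ne y 0 with rfl | hy
  · have : -(n : ℝ) + (2 - σ) ≠ 0 := by linarith
    simp [Real.zero_rpow this]
  · have hy' : 0 < ‖y‖ := norm_pos_iff.mpr hy
    rw [← Real.rpow_ofNat, ← Real.rpow_add hy']
    congr 1; ring

/-- Densities supported in `B_3` with values in `[0, L]`. -/
structure IsDensity (L : ℝ) (w : Rn n → ℝ) : Prop where
  aemeasurable : AEMeasurable w
  nonneg : ∀ t, 0 ≤ w t
  le : ∀ t, w t ≤ L
  eq_zero : ∀ t ∉ ball (0 : Rn n) 3, w t = 0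

/-- The unnormalized Riesz potential of order `2 - σ`. -/
noncomputable def rieszInt (σ : ℝ) (w : Rn n → ℝ) (x : Rn n) : ℝ :=
  ∫ t, w t * ‖x - t‖ ^ (-(n : ℝ) + (2 - σ))

variable {L : ℝ} {w : Rn n → ℝ}

/-- On the support of w one has |x - t| ≤ ρ, so the truncation is inactive and the Riesz kernel is
dominated by the integrable truncated weight. -/
lemma IsDensity.mul_le (hw : IsDensity L w) (hn : 2 ≤ n) (hσ : 0 < σ) {x : Rn n} {ρ : ℝ}
    (hρ : ‖x‖ + 3 ≤ ρ) (t : Rn n) :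
    w t * ‖x - t‖ ^ (-(n : ℝ) + (2 - σ)) ≤
      L * (min (‖x - t‖ ^ 2) (ρ ^ 2) * ‖x - t‖ ^ (-(n : ℝ) - σ)) := by
  have hL : 0 ≤ L := (hw.nonneg t).trans (hw.le t)
  by_cases ht : t ∈ ball (0 : Rn n) 3
  · have h1 : ‖x - t‖ ≤ ρ := by
      have := norm_sub_le x t
      have : ‖t‖ < 3 := by simpa using ht
      linarith
    rw [norm_rpow_eq hn hσ, min_eq_left (by gcongr)]
    gcongr
    exact hw.le t
  · rw [hw.eq_zero t ht, zero_mul]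
    positivity

lemma IsDensity.aemeasurable_mul (hw : IsDensity L w) (x : Rn n) (e : ℝ) :
    AEMeasurable (fun t => w t * ‖x - t‖ ^ e) :=
  hw.aemeasurable.mul (Measurable.aemeasurable (by fun_prop))

lemma IsDensity.integrable (hw : IsDensity L w) (hn : 2 ≤ n) (hσ : 0 < σ) (hσ2 : σ < 2)
    (x : Rn n) : Integrable fun t => w t * ‖x - t‖ ^ (-(n : ℝ) + (2 - σ)) := by
  have hρ : 0 < ‖x‖ + 3 := by positivity
  have h1 := (((integral_truncated_weight (n := n) hn hσ hσ2 hρ).1.comp_sub_left x).const_mul L)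
  refine h1.mono' (hw.aemeasurable_mul x _).aestronglyMeasurable ?_
  refine Filter.Eventually.of_forall fun t => ?_
  rw [Real.norm_of_nonneg (mul_nonneg (hw.nonneg t) (by positivity))]
  exact hw.mul_le hn hσ le_rfl t

lemma IsDensity.rieszInt_nonneg (hw : IsDensity L w) (x : Rn n) : 0 ≤ rieszInt σ w x :=
  integral_nonneg fun t => mul_nonneg (hw.nonneg t) (by positivity)

lemma IsDensity.rieszInt_le (hw : IsDensity L w) (hn : 2 ≤ n) (hσ : 0 < σ) (hσ2 : σ < 2)
    {x : Rn n} (hx : ‖x‖ ≤ 3) :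
    rieszInt σ w x ≤
      L * (n * volume.real (ball (0 : Rn n) 1) * ((6 : ℝ) ^ (2 - σ) * (2 / (σ * (2 - σ))))) := by
  obtain ⟨h1, h2⟩ := integral_truncated_weight (n := n) hn hσ hσ2 (ρ := 6) (by norm_num)
  rw [← h2, ← integral_sub_left_eq_self _ volume x, ← integral_const_mul]
  refine integral_mono (hw.integrable hn hσ hσ2 x) ((h1.comp_sub_left x).const_mul L) fun t => ?_
  exact hw.mul_le hn hσ (by linarith) t

lemma norm_radial_proj_sub_le {x t : Rn n} (hx : 3 ≤ ‖x‖) (ht : ‖t‖ < 3) :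
    ‖(3 / ‖x‖) • x - t‖ ≤ ‖x - t‖ := by
  have hx0 : 0 < ‖x‖ := by linarith
  set a := 3 / ‖x‖ with ha
  have hax : a * ‖x‖ = 3 := div_mul_cancel₀ _ hx0.ne'
  have ha0 : 0 < a := by positivity
  have ha1 : a ≤ 1 := (div_le_one hx0).mpr hx
  refine le_of_sq_le_sq ?_ (norm_nonneg _)
  rw [norm_sub_sq_real, norm_sub_sq_real, norm_smul, Real.norm_of_nonneg ha0.le, inner_smul_left]
  simp only [conj_trivial]
  have hin : inner ℝ x t ≤ ‖x‖ * 3 :=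
    (real_inner_le_norm x t).trans (by gcongr)
  rw [hax]
  have h2 : (1 - a) * inner ℝ x t ≤ (1 - a) * (‖x‖ * 3) :=
    mul_le_mul_of_nonneg_left hin (by linarith)
  have h3 : (1 - a) * (‖x‖ * 3) = 3 * ‖x‖ - 9 := by
    have : (1 - a) * (‖x‖ * 3) = 3 * ‖x‖ - 3 * (a * ‖x‖) := by ring
    rw [this, hax]; ring
  nlinarith [sq_nonneg (‖x‖ - 3)]

/-- Radial projection onto the closed ball increases the potential. -/
lemma IsDensity.rieszInt_le_radial_proj (hw : IsDensity L w) (hn : 2 ≤ n) (hσ : 0 < σ)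
    (hσ2 : σ < 2) {x : Rn n} (hx : 3 ≤ ‖x‖) :
    rieszInt σ w x ≤ rieszInt σ w ((3 / ‖x‖) • x) := by
  have hn' : (2 : ℝ) ≤ n := by exact_mod_cast hn
  refine integral_mono (hw.integrable hn hσ hσ2 x) (hw.integrable hn hσ hσ2 _) fun t => ?_
  by_cases ht : t ∈ ball (0 : Rn n) 3
  · have ht3 : ‖t‖ < 3 := by simpa using ht
    refine mul_le_mul_of_nonneg_left ?_ (hw.nonneg t)
    refine Real.rpow_le_rpow_of_nonpos ?_ (norm_radial_proj_sub_le hx ht3) (by linarith)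
    rw [norm_pos_iff, sub_ne_zero]
    rintro rfl
    have hx0 : 0 < ‖x‖ := by linarith
    rw [norm_smul, norm_div, norm_norm, div_mul_cancel₀ _ hx0.ne'] at ht3
    norm_num at ht3
  · simp [hw.eq_zero t ht]

/-- Lower semicontinuity of the potential along the ray from the origin. -/
lemma IsDensity.exists_mem_ball_lt_rieszInt_of_norm_le (hw : IsDensity L w) (hn : 2 ≤ n) (hσ : 0 < σ)
    (hσ2 : σ < 2) {x : Rn n} (hx : ‖x‖ ≤ 3) {b : ℝ} (hb : b < rieszInt σ w x) :
    ∃ y ∈ ball (0 : Rn n) 3, b < rieszInt σ w y := by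
  have : NeZero n := ⟨by omega⟩
  by_contra! hcon
  set e : ℝ := -(n : ℝ) + (2 - σ) with he
  set xs : ℕ → Rn n := fun k => (1 - 1 / ((k : ℝ) + 1)) • x with hxs
  have hmem : ∀ k, xs k ∈ ball (0 : Rn n) 3 := by
    intro k
    have h1 : 0 < 1 / ((k : ℝ) + 1) := by positivity
    have h2 : 1 / ((k : ℝ) + 1) ≤ 1 := by
      rw [div_le_one (by positivity)]
      have : (0 : ℝ) ≤ k := k.cast_nonneg
      linarith
    rw [mem_ball_zero_iff, hxs, norm_smul, Real.norm_of_nonneg (by linarith)]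
    calc _ ≤ (1 - 1 / ((k : ℝ) + 1)) * 3 := by gcongr
      _ < 3 := by linarith
  have htend : Filter.Tendsto xs Filter.atTop (nhds x) := by
    have h1 : Filter.Tendsto (fun k : ℕ => (1 : ℝ) - 1 / ((k : ℝ) + 1)) Filter.atTop
        (nhds (1 - 0)) := tendsto_const_nhds.sub tendsto_one_div_add_atTop_nhds_zero_nat
    have := h1.smul_const x
    simpa [hxs] using this
  have hnn : ∀ y : Rn n, 0 ≤ᵐ[volume] fun t => w t * ‖y - t‖ ^ e := fun y =>
    Filter.Eventually.of_forall fun t => mul_nonneg (hw.nonneg t) (by positivity)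
  have hval : ∀ y : Rn n, ENNReal.ofReal (rieszInt σ w y) =
      ∫⁻ t, ENNReal.ofReal (w t * ‖y - t‖ ^ e) := fun y =>
    ofReal_integral_eq_lintegral_ofReal (hw.integrable hn hσ hσ2 y) (hnn y)
  -- If the potential were at most b throughout the open ball, Fatou along the points xs k tending
  -- to x would carry the bound over to x.
  have hfatou := lintegral_liminf_le' (μ := volume) (u := Filter.atTop)
    (f := fun (k : ℕ) t => ENNReal.ofReal (w t * ‖xs k - t‖ ^ e))
    (fun k => (hw.aemeasurable_mul (xs k) e).ennreal_ofReal)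
  have hlim : ∀ᵐ t : Rn n, ENNReal.ofReal (w t * ‖x - t‖ ^ e) =
      Filter.liminf (fun k => ENNReal.ofReal (w t * ‖xs k - t‖ ^ e)) Filter.atTop := by
    filter_upwards [compl_mem_ae_iff.mpr (measure_singleton (μ := volume) x)] with t ht
    refine (Filter.Tendsto.liminf_eq ?_).symm
    refine ENNReal.tendsto_ofReal (Filter.Tendsto.const_mul _ ?_)
    have hne : ‖x - t‖ ≠ 0 := by
      rw [norm_ne_zero_iff, sub_ne_zero]
      exact fun h => ht h.symm
    exact ((htend.sub_const t).norm).rpow_const (Or.inl hne)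
  rw [← lintegral_congr_ae hlim, ← hval] at hfatou
  have hle : Filter.liminf (fun k => ∫⁻ t, ENNReal.ofReal (w t * ‖xs k - t‖ ^ e)) Filter.atTop ≤
      ENNReal.ofReal b := by
    refine Filter.liminf_le_of_frequently_le' (Filter.Frequently.of_forall fun k => ?_)
    rw [← hval]
    exact ENNReal.ofReal_le_ofReal (hcon _ (hmem k))
  have hpos : 0 ≤ b := (hw.rieszInt_nonneg 0).trans (hcon 0 (by simp))
  have := (ENNReal.ofReal_le_ofReal_iff hpos).mp (hfatou.trans hle)
  linarith

lemma IsDensity.exists_mem_ball_lt_rieszInt (hw : IsDensity L w) (hn : 2 ≤ n) (hσ : 0 < σ)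
    (hσ2 : σ < 2) {x : Rn n} {b : ℝ} (hb : b < rieszInt σ w x) :
    ∃ y ∈ ball (0 : Rn n) 3, b < rieszInt σ w y := by
  rcases le_total ‖x‖ 3 with hx | hx
  · exact hw.exists_mem_ball_lt_rieszInt_of_norm_le hn hσ hσ2 hx hb
  · refine hw.exists_mem_ball_lt_rieszInt_of_norm_le hn hσ hσ2 (x := (3 / ‖x‖) • x) ?_
      (hb.trans_le (hw.rieszInt_le_radial_proj hn hσ hσ2 hx))
    have hx0 : 0 < ‖x‖ := by linarith
    rw [norm_smul, norm_div, norm_norm, div_mul_cancel₀ _ hx0.ne']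
    norm_num

/-- If `P` is a negative multiple of the potential of a density, its infimum is that over `B_3`. -/
lemma IsDensity.sInf_eq (hw : IsDensity L w) (hn : 2 ≤ n) (hσ : 0 < σ)
    (hσ2 : σ < 2) {A : ℝ} (hA : 0 < A) {P : Rn n → ℝ} (hP : ∀ x, P x = -(A * rieszInt σ w x)) :
    BddBelow (Set.range P) ∧ sInf (Set.range P) = sInf (P '' ball 0 3) := by
  set K := L * (n * volume.real (ball (0 : Rn n) 1) *
    ((6 : ℝ) ^ (2 - σ) * (2 / (σ * (2 - σ))))) with hK
  have hbound : ∀ x, rieszInt σ w x ≤ K := by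
    intro x
    by_contra! hcon
    obtain ⟨y, hy, hy2⟩ := hw.exists_mem_ball_lt_rieszInt hn hσ hσ2 hcon
    have := hw.rieszInt_le hn hσ hσ2 (x := y) (by simpa using (mem_ball_zero_iff.mp hy).le)
    linarith
  have hbdd : BddBelow (Set.range P) := by
    refine ⟨-(A * K), ?_⟩
    rintro _ ⟨x, rfl⟩
    rw [hP]
    have := mul_le_mul_of_nonneg_left (hbound x) hA.le
    linarith
  have hsub : P '' ball 0 3 ⊆ Set.range P := Set.image_subset_range _ _
  have hne : (P '' ball 0 3).Nonempty := ⟨P 0, 0, by simp, rfl⟩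
  refine ⟨hbdd, le_antisymm (csInf_le_csInf hbdd hne hsub) ?_⟩
  refine le_csInf (Set.range_nonempty P) ?_
  rintro _ ⟨x, rfl⟩
  by_contra! hcon
  have h1 : -(sInf (P '' ball 0 3)) / A < rieszInt σ w x := by
    rw [div_lt_iff₀ hA]
    rw [hP] at hcon
    linarith
  obtain ⟨y, hy, hy2⟩ := hw.exists_mem_ball_lt_rieszInt hn hσ hσ2 h1
  have h2 : sInf (P '' ball 0 3) ≤ P y := csInf_le (hbdd.mono hsub) ⟨y, hy, rfl⟩
  rw [div_lt_iff₀ hA] at hy2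
  rw [hP] at h2
  linarith

end Potential
-- The integral estimate at a contact point
section ContactEstimate
variable {n : ℕ} {σ : ℝ}

lemma rieszInt_eq_add (w : Rn n → ℝ) (x : Rn n) :
    rieszInt σ w x = ∫ y, w (x + y) * ‖y‖ ^ (-(n : ℝ) + (2 - σ)) := by
  rw [rieszInt, ← integral_add_left_eq_self _ x]
  simp

lemma rieszInt_eq_sub (w : Rn n → ℝ) (x : Rn n) :
    rieszInt σ w x = ∫ y, w (x - y) * ‖y‖ ^ (-(n : ℝ) + (2 - σ)) := by
  rw [rieszInt, ← integral_sub_left_eq_self _ volume x]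
  simp

/-- The multiple Λ Id is admissible precisely because λ ≤ nΛ. Nonemptiness is needed to bound the
infimum `minOp` from below. -/
lemma nonempty_ellipticMatrices {lam Lam : ℝ} (hn : 2 ≤ n) (hlam : 0 < lam)
    (hLam : lam ≤ n * Lam) : (ellipticMatrices n lam Lam).Nonempty := by
  have hL : 0 ≤ Lam := by
    by_contra! h
    have : (0 : ℝ) < n := by positivity
    nlinarith
  refine ⟨Lam • 1, Matrix.PosSemidef.one.smul hL, ?_, ?_⟩
  · simpa [mul_comm] using hLam
  · rw [sub_self]; exact Matrix.PosSemidef.zero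

/-- Lower bound for the linear operators at a flat contact point, in terms of the potential. -/
lemma linOp_splice_ge (hn : 2 ≤ n) (hσ : 0 < σ) (hσ2 : σ < 2) {u b : Rn n → ℝ} {m M L' : ℝ}
    (hu : Measurable u) (hM : ∀ x, |u x| ≤ M) (hm : m ≤ 0) (hb : IsDensity L' b)
    (hmu : ∀ x, m ≤ u x) (hbu : ∀ x, -m ≤ b x + (u x - m)) {x : Rn n}
    {A : Matrix (Fin n) (Fin n) ℝ} (hA : A.PosSemidef) {r ρ : ℝ} (hr : 0 < r) (hρ : 0 < ρ) :
    2 * A.trace * (-m) * (volume.real (ball (0 : Rn n) 1) * (ρ ^ (2 - σ) * (2 / (σ * (2 - σ))))) ≤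
      2 * A.trace * rieszInt σ b x +
      2 * (-m) * A.trace *
        (n * volume.real (ball (0 : Rn n) 1) * (r ^ (2 - σ) * (2 / (σ * (2 - σ))))) +
      ρ ^ 2 * ∫ y, secondDiff (splice (fun _ => m) u x r) x y * quadKernel σ A y := by
  have hφ : ContDiff ℝ 2 (fun _ : Rn n => m) := contDiff_const
  obtain ⟨C, hC⟩ := exists_quadBound_splice hφ hM x hr
  have hmeas := measurable_secondDiff (measurable_splice (φ := fun _ => m) measurable_const hu x r) x
  have iD := hC.integrable hn hσ hσ2 hmeas A
  obtain ⟨i1, e1⟩ := integral_truncated_quadKernel hn hσ hσ2 hρ A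
  obtain ⟨i2, e2⟩ := integral_truncated_weight (n := n) hn hσ hσ2 hr
  have i3 : Integrable fun y => b (x + y) * ‖y‖ ^ (-(n : ℝ) + (2 - σ)) := by
    have := (hb.integrable hn hσ hσ2 x).comp_add_left x
    simpa using this
  have i4 : Integrable fun y => b (x - y) * ‖y‖ ^ (-(n : ℝ) + (2 - σ)) := by
    have := (hb.integrable hn hσ hσ2 x).comp_sub_left x
    simpa using this
  have ht : 0 ≤ A.trace := hA.trace_nonneg
  -- For |y| < r the spliced function is constant and the operator sees nothing; the term truncated
  -- at r pays for that region and vanishes as r → 0.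
  have hpt : ∀ y, 2 * (-m) * (min (‖y‖ ^ 2) (ρ ^ 2) * quadKernel σ A y) ≤
      A.trace * (b (x + y) * ‖y‖ ^ (-(n : ℝ) + (2 - σ)) +
        b (x - y) * ‖y‖ ^ (-(n : ℝ) + (2 - σ))) +
      2 * (-m) * A.trace * (min (‖y‖ ^ 2) (r ^ 2) * ‖y‖ ^ (-(n : ℝ) - σ)) +
      ρ ^ 2 * (secondDiff (splice (fun _ => m) u x r) x y * quadKernel σ A y) := by
    intro y
    have hk := quadKernel_nonneg (σ := σ) hA y
    have hk2 := quadKernel_le hσ hA y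
    set k := quadKernel σ A y
    set W := ‖y‖ ^ (-(n : ℝ) - σ) with hW
    have hW0 : 0 ≤ W := by positivity
    have b1 := hb.nonneg (x + y)
    have b2 := hb.nonneg (x - y)
    rw [norm_rpow_eq hn hσ]
    have hmin1 : min (‖y‖ ^ 2) (ρ ^ 2) ≤ ‖y‖ ^ 2 := min_le_left _ _
    have hmin2 : min (‖y‖ ^ 2) (ρ ^ 2) ≤ ρ ^ 2 := min_le_right _ _
    have hmin0 : 0 ≤ min (‖y‖ ^ 2) (ρ ^ 2) := by positivity
    have hy2 : 0 ≤ ‖y‖ ^ 2 := by positivity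
    rcases lt_or_ge ‖y‖ r with hy | hy
    · rw [secondDiff_splice_of_lt hy, min_eq_left (b := r ^ 2) (by gcongr)]
      have e : secondDiff (fun _ : Rn n => m) x y = 0 := by simp [secondDiff]; ring
      rw [e]
      have h1 : min (‖y‖ ^ 2) (ρ ^ 2) * k ≤ ‖y‖ ^ 2 * (A.trace * W) := by gcongr
      have h2 : 2 * (-m) * (min (‖y‖ ^ 2) (ρ ^ 2) * k) ≤ 2 * (-m) * (‖y‖ ^ 2 * (A.trace * W)) :=
        mul_le_mul_of_nonneg_left h1 (by linarith)
      have h3 : 0 ≤ A.trace * (b (x + y) * (‖y‖ ^ 2 * W) + b (x - y) * (‖y‖ ^ 2 * W)) := by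
        positivity
      linarith
    · rw [secondDiff_splice_of_le hr hy]
      have h3 : 0 ≤ 2 * (-m) * A.trace * (min (‖y‖ ^ 2) (r ^ 2) * W) :=
        mul_nonneg (mul_nonneg (by linarith) ht) (by positivity)
      have g1 := hbu (x + y)
      have g2 := hbu (x - y)
      -- The heart of the estimate: in -m ≤ b + (u - m), bound the truncated weight by |y|² against
      -- b and by ρ² against u - m.
      have p : ∀ z, (-m) * (min (‖y‖ ^ 2) (ρ ^ 2) * k) ≤
          A.trace * (b z * (‖y‖ ^ 2 * W)) + ρ ^ 2 * ((u z - m) * k) := by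
        intro z
        have hz0 := hb.nonneg z
        have q1 : (-m) * (min (‖y‖ ^ 2) (ρ ^ 2) * k) ≤
            (b z + (u z - m)) * (min (‖y‖ ^ 2) (ρ ^ 2) * k) := by
          gcongr
          exact hbu z
        have q2 : b z * (min (‖y‖ ^ 2) (ρ ^ 2) * k) ≤ b z * (‖y‖ ^ 2 * (A.trace * W)) := by gcongr
        have h' : 0 ≤ u z - m := sub_nonneg.mpr (hmu z)
        have q3 : (u z - m) * (min (‖y‖ ^ 2) (ρ ^ 2) * k) ≤ (u z - m) * (ρ ^ 2 * k) := by gcongr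
        linarith
      have p1 := p (x + y)
      have p2 := p (x - y)
      linarith
  have h1 := integral_mono (i1.const_mul (2 * (-m)))
    ((((i3.add i4).const_mul A.trace).add (i2.const_mul _)).add (iD.const_mul _)) hpt
  rw [integral_add' (((i3.add i4).const_mul A.trace).add (i2.const_mul _)) (iD.const_mul _),
    integral_add' ((i3.add i4).const_mul A.trace) (i2.const_mul _), integral_const_mul,
    integral_const_mul, integral_const_mul, integral_const_mul, integral_add' i3 i4,
    ← rieszInt_eq_add, ← rieszInt_eq_sub, e1, e2] at h1
  linarith

/-- At a contact point of the obstacle with its minimum, the right-hand side controls how small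
the potential of the obstacle can be. -/
lemma supersol_estimate (hn : 2 ≤ n) (hσ : 0 < σ) (hσ2 : σ < 2) {lam Lam : ℝ} (hlam : 0 < lam)
    (hLam : lam ≤ n * Lam) {f u b : Rn n → ℝ} {m M L' : ℝ} (hu : Measurable u)
    (hM : ∀ x, |u x| ≤ M) (hm : m ≤ 0) (hb : IsDensity L' b) (hmu : ∀ x, m ≤ u x)
    (hbu : ∀ x, -m ≤ b x + (u x - m))
    (hsup : ViscSupersol (minOp σ lam Lam) f (ball 0 1) u) {x : Rn n}
    (hx : x ∈ ball (0 : Rn n) 1) (hux : u x = m) (hf : 0 ≤ f x) {ρ : ℝ} (hρ : 0 < ρ) :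
    2 * (2 - σ) * lam *
      ((-m) * (volume.real (ball (0 : Rn n) 1) * (ρ ^ (2 - σ) * (2 / (σ * (2 - σ))))) -
        rieszInt σ b x) ≤ ρ ^ 2 * f x := by
  have hs : 0 < 2 - σ := by linarith
  set Q : ℝ → ℝ := fun r => (-m) * (volume.real (ball (0 : Rn n) 1) *
    (ρ ^ (2 - σ) * (2 / (σ * (2 - σ))))) - rieszInt σ b x -
    (-m) * (n * volume.real (ball (0 : Rn n) 1) * (r ^ (2 - σ) * (2 / (σ * (2 - σ))))) with hQ
  have hr : ∀ᶠ r in nhdsWithin (0 : ℝ) (Set.Ioi 0), 2 * (2 - σ) * lam * Q r ≤ ρ ^ 2 * f x := by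
    obtain ⟨R, hR, hRs⟩ := Metric.isOpen_iff.mp isOpen_ball x hx
    filter_upwards [self_mem_nhdsWithin, nhdsWithin_le_nhds (gt_mem_nhds hR)] with r hr hrR
    have hr : 0 < r := hr
    -- Replacing Tr A by λ requires Q r ≥ 0; when Q r < 0 the claim is immediate from f ≥ 0.
    rcases lt_or_ge (Q r) 0 with hneg | hpos
    · have h1 : 2 * (2 - σ) * lam * Q r ≤ 0 :=
        mul_nonpos_of_nonneg_of_nonpos (by positivity) hneg.le
      exact h1.trans (by positivity)
    have h1 := hsup x hx r hr ((ball_subset_ball hrR.le).trans hRs) (fun _ => m) contDiff_const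
      hux.symm (fun z _ => hmu z)
    have h2 : 2 * (2 - σ) * lam * Q r / ρ ^ 2 ≤
        minOp σ lam Lam (splice (fun _ => m) u x r) x := by
      refine le_csInf ((nonempty_ellipticMatrices hn hlam hLam).image _) ?_
      rintro _ ⟨A, ⟨hA, htr, -⟩, rfl⟩
      have h3 := linOp_splice_ge hn hσ hσ2 hu hM hm hb hmu hbu (x := x) hA hr hρ
      dsimp only
      rw [linOp_eq, div_le_iff₀ (by positivity)]
      set I := ∫ y, secondDiff (splice (fun _ => m) u x r) x y * quadKernel σ A y
      have h4 : 2 * A.trace * Q r ≤ ρ ^ 2 * I := by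
        simp only [hQ]; linarith
      have h5 : 2 * lam * Q r ≤ 2 * A.trace * Q r := by gcongr
      calc 2 * (2 - σ) * lam * Q r = (2 - σ) * (2 * lam * Q r) := by ring
        _ ≤ (2 - σ) * (ρ ^ 2 * I) := mul_le_mul_of_nonneg_left (h5.trans h4) hs.le
        _ = _ := by ring
    have h3 := h2.trans h1
    rwa [div_le_iff₀' (by positivity)] at h3
  have hlim : Filter.Tendsto (fun r => 2 * (2 - σ) * lam * Q r) (nhdsWithin 0 (Set.Ioi 0))
      (nhds (2 * (2 - σ) * lam * Q 0)) := by
    refine Filter.Tendsto.mono_left (Continuous.tendsto ?_ 0) nhdsWithin_le_nhds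
    have : Continuous fun r : ℝ => r ^ (2 - σ) := Real.continuous_rpow_const hs.le
    simp only [hQ]
    fun_prop
  have h := le_of_tendsto hlim hr
  simpa [hQ, Real.zero_rpow hs.ne'] using h

end ContactEstimate

/-! ### Gamma function bounds, the Riesz constant, and the choice of scale -/

section Constants

/-- Convexity together with Γ(1) = Γ(2) = 1 gives Γ ≥ 1 on (0,1] and on [2,∞). On [1,2], xΓ(x) =
Γ(x+1) ≥ 1 and x ≤ 2. -/
lemma one_half_le_Gamma {x : ℝ} (hx : 0 < x) : 1 / 2 ≤ Real.Gamma x := by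
  have h1 : ∀ y : ℝ, 0 < y → y ≤ 1 → 1 ≤ Real.Gamma y := by
    intro y hy hy1
    by_contra! h
    have := Real.convexOn_Gamma.2 (Set.mem_Ioi.mpr hy) (Set.mem_Ioi.mpr two_pos)
      (show 0 ≤ 1 / (2 - y) from div_nonneg zero_le_one (by linarith))
      (show 0 ≤ 1 - 1 / (2 - y) by rw [sub_nonneg, div_le_one (by linarith)]; linarith) (by ring)
    simp only [smul_eq_mul, Real.Gamma_two, mul_one] at this
    have e : 1 / (2 - y) * y + (1 - 1 / (2 - y)) * 2 = 1 := by
      have : 2 - y ≠ 0 := by linarith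
      field_simp; ring
    rw [e, Real.Gamma_one] at this
    have hp : 0 < 1 / (2 - y) := div_pos zero_lt_one (by linarith)
    nlinarith
  have h2 : ∀ y : ℝ, 2 ≤ y → 1 ≤ Real.Gamma y := by
    intro y hy
    rcases eq_or_lt_of_le hy with rfl | hy
    · rw [Real.Gamma_two]
    by_contra! h
    have := Real.convexOn_Gamma.2 (Set.mem_Ioi.mpr one_pos)
      (Set.mem_Ioi.mpr (two_pos.trans hy))
      (show 0 ≤ 1 - 1 / (y - 1) by rw [sub_nonneg, div_le_one (by linarith)]; linarith)
      (show 0 ≤ 1 / (y - 1) from div_nonneg zero_le_one (by linarith)) (by ring)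
    simp only [smul_eq_mul, Real.Gamma_one, mul_one] at this
    have e : (1 - 1 / (y - 1)) + 1 / (y - 1) * y = 2 := by
      have : y - 1 ≠ 0 := by linarith
      field_simp; ring
    rw [e, Real.Gamma_two] at this
    have hp : 0 < 1 / (y - 1) := div_pos zero_lt_one (by linarith)
    nlinarith
  rcases le_total x 1 with h | h
  · linarith [h1 x hx h]
  rcases le_total 2 x with h' | h'
  · linarith [h2 x h']
  · have h3 := h2 (x + 1) (by linarith)
    rw [Real.Gamma_add_one hx.ne'] at h3
    nlinarith [Real.Gamma_pos_of_pos hx]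

lemma Gamma_le_one {x : ℝ} (h1 : 1 ≤ x) (h2 : x ≤ 2) : Real.Gamma x ≤ 1 := by
  have := Real.convexOn_Gamma.2 (Set.mem_Ioi.mpr one_pos) (Set.mem_Ioi.mpr two_pos)
    (show 0 ≤ 2 - x by linarith) (show 0 ≤ x - 1 by linarith) (by ring)
  simp only [smul_eq_mul, Real.Gamma_one, Real.Gamma_two] at this
  have e : (2 - x) * 1 + (x - 1) * 2 = x := by ring
  rw [e] at this
  linarith

/-- The factor 2 - σ is the pole of Γ at 0 in the denominator: sΓ(s) = Γ(s+1) ≤ 1 for s = (2-σ)/2.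
It absorbs the factor 2 - σ left by `optimize_scale`. -/
lemma rieszConst_ge {n : ℕ} {σ : ℝ} (hn : 2 ≤ n) (hσ : 0 < σ) (hσ2 : σ < 2) :
    Real.pi ^ (-(n : ℝ) / 2) / 4 * (2 - σ) ≤ rieszConst n (2 - σ) := by
  have hn' : (2 : ℝ) ≤ n := by exact_mod_cast hn
  have hs : 0 < (2 - σ) / 2 := by linarith
  have h1 := one_half_le_Gamma (x := ((n : ℝ) - (2 - σ)) / 2) (by linarith)
  have h2 := Gamma_le_one (x := (2 - σ) / 2 + 1) (by linarith) (by linarith)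
  rw [Real.Gamma_add_one hs.ne'] at h2
  have h3 : Real.pi ^ (-(n : ℝ) / 2) ≤ Real.pi ^ (2 - σ - (n : ℝ) / 2) :=
    Real.rpow_le_rpow_of_exponent_le (by linarith [Real.pi_gt_three]) (by linarith)
  have h4 := Real.Gamma_pos_of_pos hs
  have h5 : 0 < Real.pi ^ (-(n : ℝ) / 2) := Real.rpow_pos_of_pos Real.pi_pos _
  unfold rieszConst
  rw [le_div_iff₀ h4]
  calc _ = Real.pi ^ (-(n : ℝ) / 2) / 2 * ((2 - σ) / 2 * Real.Gamma ((2 - σ) / 2)) := by ring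
    _ ≤ Real.pi ^ (-(n : ℝ) / 2) / 2 * 1 := by gcongr
    _ = Real.pi ^ (-(n : ℝ) / 2) * (1 / 2) := by ring
    _ ≤ _ := by gcongr

/-- From log p ≥ 1 - 1/p with p = κs, one gets s log p ≥ s - 1/κ ≥ -1/κ. The bound is free of s,
which makes the final constant uniform in σ. -/
lemma exp_neg_inv_le_mul_rpow {κ s : ℝ} (hκ : 0 < κ) (hs : 0 < s) :
    Real.exp (-(1 / κ)) ≤ (κ * s) ^ s := by
  have hp : 0 < κ * s := mul_pos hκ hs
  rw [Real.rpow_def_of_pos hp, Real.exp_le_exp]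
  have h1 := Real.one_sub_inv_le_log_of_pos hp
  have h2 := mul_le_mul_of_nonneg_right h1 hs.le
  have h3 : (1 - (κ * s)⁻¹) * s = s - 1 / κ := by field_simp
  linarith

/-- Optimization over the scale `ρ`. -/
lemma optimize_scale {σ lam ω L N F : ℝ} (hσ : 0 < σ) (hσ2 : σ < 2) (hlam : 0 < lam) (hω : 0 < ω)
    (hL : 0 < L) (hN : 0 ≤ N) (hF : 0 ≤ F)
    (h : ∀ ρ : ℝ, 0 < ρ → 2 * (2 - σ) * lam *
      (L * (ω * (ρ ^ (2 - σ) * (2 / (σ * (2 - σ))))) - N) ≤ ρ ^ 2 * F) :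
    0 < F ∧ ω * Real.exp (-(1 / (4 * lam * ω))) * L ^ (2 / σ) * (1 / (2 * F)) ^ ((2 - σ) / σ) ≤
      (2 - σ) * N := by
  have hs : 0 < 2 - σ := by linarith
  -- If F = 0, the left side grows without bound in ρ; the scale chosen here makes the bracket equal
  -- to 1.
  have hFpos : 0 < F := by
    by_contra! hF0
    obtain rfl : F = 0 := le_antisymm hF0 hF
    set X := (N + 1) / (L * ω * (2 / (σ * (2 - σ)))) with hX
    have hX0 : 0 < X := by positivity
    have h1 := h (X ^ (1 / (2 - σ))) (Real.rpow_pos_of_pos hX0 _)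
    rw [← Real.rpow_mul hX0.le, one_div_mul_cancel hs.ne', Real.rpow_one, mul_zero] at h1
    have e : L * (ω * (X * (2 / (σ * (2 - σ))))) = N + 1 := by
      rw [hX]; field_simp
    rw [e] at h1
    have : 0 < 2 * (2 - σ) * lam := by positivity
    nlinarith
  refine ⟨hFpos, ?_⟩
  -- X is ρ^σ at the critical point of aρ^(2-σ) - Fρ², where a = 4λωL/σ. The term ρ²F is then the
  -- fraction (2-σ)/2 of aρ^(2-σ); the remaining σ/2 cancels the 1/σ.
  set X := 2 * (2 - σ) * lam * ω * L / (σ * F) with hX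
  have hX0 : 0 < X := by positivity
  set s := (2 - σ) / σ with hsdef
  have hs0 : 0 < s := by positivity
  set Y := X ^ s with hY
  have hY0 : 0 < Y := Real.rpow_pos_of_pos hX0 _
  have h1 := h (X ^ (1 / σ)) (Real.rpow_pos_of_pos hX0 _)
  have p1 : (X ^ (1 / σ)) ^ (2 - σ) = Y := by
    rw [← Real.rpow_mul hX0.le]; congr 1; rw [hsdef]; ring
  have p2 : (X ^ (1 / σ)) ^ 2 = Y * X := by
    rw [← Real.rpow_natCast, ← Real.rpow_mul hX0.le, hY, ← Real.rpow_add_one hX0.ne']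
    congr 1; rw [hsdef]; field_simp; push_cast; ring
  rw [p1, p2] at h1
  have e1 : Y * X * F = 2 * (2 - σ) * lam * (Y * ω * L / σ) := by
    rw [hX]; field_simp
  rw [e1] at h1
  have h2 := le_of_mul_le_mul_left h1 (by positivity)
  have e2 : L * (ω * (Y * (2 / (σ * (2 - σ))))) - Y * ω * L / σ = Y * ω * L / (2 - σ) := by
    field_simp; ring
  have h3 : Y * ω * L / (2 - σ) ≤ N := by linarith
  rw [div_le_iff₀ hs] at h3
  have e3 : X = (4 * lam * ω * s) * L * (1 / (2 * F)) := by
    rw [hX, hsdef]; field_simp; norm_num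
  have e4 : Y = (4 * lam * ω * s) ^ s * L ^ s * (1 / (2 * F)) ^ s := by
    rw [hY, e3, Real.mul_rpow (by positivity) (by positivity),
      Real.mul_rpow (by positivity) hL.le]
  have e5 : L ^ (2 / σ) = L ^ s * L := by
    rw [← Real.rpow_add_one hL.ne']
    congr 1; rw [hsdef]; field_simp; ring
  have h4 := exp_neg_inv_le_mul_rpow (κ := 4 * lam * ω) (by positivity) hs0
  calc _ ≤ ω * (4 * lam * ω * s) ^ s * L ^ (2 / σ) * (1 / (2 * F)) ^ s := by gcongr
    _ = Y * ω * L := by rw [e4, e5]; ring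
    _ ≤ _ := by linarith

end Constants
-- Assembly
section Main
variable {n : ℕ} {σ : ℝ} {u : Rn n → ℝ}

lemma isDensity_neg_envelope (hn : 2 ≤ n) (hσ : 0 < σ) (hσ2 : σ < 2) {m : ℝ} (hm : m ≤ 0)
    (hmq : ∀ x, m ≤ obstacle u x) (h0 : ∀ x, obstacle u x ≤ 0) :
    IsDensity (-m) fun x => -envelope σ u x where
  aemeasurable := (aemeasurable_envelope hn hσ hσ2 hm hmq).neg
  nonneg t := by
    have := (envelope_le ⟨_, barrier_zero_mem hn hσ hσ2 hm hmq⟩ t).trans (h0 t)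
    linarith
  le t := neg_le_neg (le_envelope_of_le_obstacle hn hσ hσ2 hm hmq t)
  eq_zero t ht := by simp only [envelope_eq_zero hn hσ hσ2 hm hmq ht, neg_zero]

lemma isDensity_neg_obstacle {m : ℝ} (hmeas : Measurable (obstacle u))
    (hmq : ∀ x, m ≤ obstacle u x) (h0 : ∀ x, obstacle u x ≤ 0) :
    IsDensity (-m) fun x => -obstacle u x where
  aemeasurable := hmeas.neg.aemeasurable
  nonneg t := neg_nonneg.mpr (h0 t)
  le t := neg_le_neg (hmq t)
  eq_zero t ht := by
    rw [obstacle_of_notMem fun h => ht (ball_subset_ball (by norm_num) h), neg_zero]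

lemma potential_eq (x : Rn n) :
    potential σ u x =
      -(rieszConst n (2 - σ) * rieszInt σ (fun t => -envelope σ u t) x) := by
  simp only [potential, convolution, ContinuousLinearMap.lsmul_apply, smul_eq_mul, rieszKernel,
    rieszInt, neg_mul, integral_neg, mul_neg, neg_neg]
  rw [← integral_const_mul]
  congr 1
  ext t
  ring

lemma convolutionExists_envelope (hn : 2 ≤ n) (hσ : 0 < σ) (hσ2 : σ < 2) {L : ℝ}
    (hw : IsDensity L fun x => -envelope σ u x) :
    ConvolutionExists (envelope σ u) (rieszKernel n (2 - σ)) (ContinuousLinearMap.lsmul ℝ ℝ) := by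
  intro x
  refine ((hw.integrable hn hσ hσ2 x).const_mul (-rieszConst n (2 - σ))).congr ?_
  refine Filter.Eventually.of_forall fun t => ?_
  simp only [ContinuousLinearMap.lsmul_apply, smul_eq_mul, rieszKernel]
  ring

end Main
end FracABP

theorem proposition4p5 (n : ℕ) (hn : 2 ≤ n) (lam : ℝ) (hlam : 0 < lam) :
    ∃ C : ℝ, 0 < C ∧
      ∀ (σ Lam : ℝ), 0 < σ → σ < 2 → lam ≤ n * Lam →
      ∀ (f u : EuclideanSpace ℝ (Fin n) → ℝ),
        ContinuousOn f (closedBall 0 1) → (∀ x ∈ closedBall 0 1, 0 ≤ f x) →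
        LowerSemicontinuous u → (∃ M : ℝ, ∀ x, |u x| ≤ M) →
        (∀ x ∈ ball 0 1, u x ≤ 0) → (∀ x ∉ ball 0 1, 0 ≤ u x) →
        FracABP.ViscSupersol (FracABP.minOp σ lam Lam) f (ball 0 1) u →
      ∀ x₀ : EuclideanSpace ℝ (Fin n),
        (∀ x, FracABP.envelope σ u x₀ ≤ FracABP.envelope σ u x) →
        ConvolutionExists (FracABP.envelope σ u) (FracABP.rieszKernel n (2 - σ))
          (ContinuousLinearMap.lsmul ℝ ℝ) ∧
        BddBelow (Set.range (FracABP.potential σ u)) ∧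
        (FracABP.envelope σ u x₀ < 0 → x₀ ∈ ball 0 1 ∧ 0 < f x₀) ∧
        -sInf (Set.range (FracABP.potential σ u)) =
          -sInf (FracABP.potential σ u '' ball 0 3) ∧
        C * (-FracABP.envelope σ u x₀) ^ (2 / σ) * (1 / (2 * f x₀)) ^ ((2 - σ) / σ) ≤
          -sInf (FracABP.potential σ u '' ball 0 3) := by
  open FracABP in
  have : NeZero n := ⟨by omega⟩
  set ω := volume.real (ball (0 : Rn n) 1) with hω
  have hω0 : 0 < ω := by
    rw [hω, Measure.real]
    exact ENNReal.toReal_pos (measure_ball_pos volume _ one_pos).ne' measure_ball_lt_top.ne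
  have hπ : 0 < Real.pi ^ (-(n : ℝ) / 2) := Real.rpow_pos_of_pos Real.pi_pos _
  -- The first factor comes from `rieszConst_ge`, the second from `optimize_scale`.
  refine ⟨Real.pi ^ (-(n : ℝ) / 2) / 4 * (ω * Real.exp (-(1 / (4 * lam * ω)))), by positivity, ?_⟩
  intro σ Lam hσ hσ2 hLam f u _ hf hu ⟨M, hM⟩ hu1 hu2 hsup x₀ hx₀
  have hq := lowerSemicontinuous_obstacle hu hu1 hu2
  have h0 : ∀ x, obstacle u x ≤ 0 := fun x => by
    rw [obstacle_eq_min hu1 hu2]; exact min_le_right _ _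
  obtain ⟨z, hz⟩ := exists_obstacle_min hq h0
  set m := obstacle u z with hm
  have hm0 : m ≤ 0 := h0 z
  have hw := isDensity_neg_envelope (σ := σ) hn hσ hσ2 hm0 hz h0
  have hne : (envelopeClass σ u).Nonempty := ⟨_, barrier_zero_mem hn hσ hσ2 hm0 hz⟩
  have hA := rieszConst_pos hn hσ hσ2
  obtain ⟨hbdd, hinf⟩ := hw.sInf_eq hn hσ hσ2 hA (potential_eq (σ := σ) (u := u))
  have hlow : ∀ x ∈ ball (0 : Rn n) 3,
      rieszConst n (2 - σ) * rieszInt σ (fun t => -envelope σ u t) x ≤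
        -sInf (potential σ u '' ball 0 3) := by
    intro x hx
    have := csInf_le (hbdd.mono (Set.image_subset_range _ _)) ⟨x, hx, rfl⟩
    rw [potential_eq] at this
    linarith
  have hx₀m : envelope σ u x₀ = m :=
    le_antisymm ((hx₀ z).trans (envelope_le hne z)) (le_envelope_of_le_obstacle hn hσ hσ2 hm0 hz x₀)
  have hmain : m < 0 → x₀ ∈ ball 0 1 ∧ 0 < f x₀ ∧
      ω * Real.exp (-(1 / (4 * lam * ω))) * (-m) ^ (2 / σ) * (1 / (2 * f x₀)) ^ ((2 - σ) / σ) ≤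
        (2 - σ) * rieszInt σ (fun t => -obstacle u t) x₀ := by
    intro hmneg
    have hx3 : x₀ ∈ ball (0 : Rn n) 3 := by
      by_contra h
      rw [envelope_eq_zero hn hσ hσ2 hm0 hz h] at hx₀m
      linarith
    have hqx : obstacle u x₀ = m := by
      refine le_antisymm (not_lt.mp fun h => ?_) (hz x₀)
      have := lt_envelope_of_lt_obstacle hn hσ hσ2 hmneg hz hq hx3 h h0
      linarith
    have hx1 : x₀ ∈ ball (0 : Rn n) 1 := by
      by_contra h
      rw [obstacle_of_notMem h] at hqx
      linarith
    have hux : u x₀ = m := by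
      rw [← hqx, obstacle, Set.indicator_of_mem hx1]
    have hqu : ∀ x, obstacle u x ≤ u x := fun x => by
      rw [obstacle_eq_min hu1 hu2]; exact min_le_left _ _
    have hb := isDensity_neg_obstacle hq.measurable hz h0
    refine ⟨hx1, optimize_scale hσ hσ2 hlam hω0 (by linarith) (hb.rieszInt_nonneg x₀)
      (hf x₀ (ball_subset_closedBall hx1)) fun ρ hρ => ?_⟩
    exact supersol_estimate hn hσ hσ2 hlam hLam hu.measurable hM hm0 hb
      (fun x => (hz x).trans (hqu x)) (fun x => by linarith [hqu x]) hsup hx1 hux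
      (hf x₀ (ball_subset_closedBall hx1)) hρ
  refine ⟨convolutionExists_envelope hn hσ hσ2 hw, hbdd, ?_, by rw [hinf], ?_⟩
  · intro h
    rw [hx₀m] at h
    exact ⟨(hmain h).1, (hmain h).2.1⟩
  rw [hx₀m]
  rcases eq_or_lt_of_le hm0 with h | h
  · rw [h, neg_zero, Real.zero_rpow (by positivity), mul_zero, zero_mul]
    refine le_trans ?_ (hlow 0 (by simp))
    exact mul_nonneg hA.le (hw.rieszInt_nonneg 0)
  · obtain ⟨hx1, hfx, hest⟩ := hmain h
    refine le_trans ?_ (hlow x₀ (ball_subset_ball (by norm_num) hx1))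
    have hb := isDensity_neg_obstacle hq.measurable hz h0
    -- The contact estimate bounds the potential of the obstacle; since Γ lies below it, passing to
    -- Γ only increases the potential.
    have hmono : rieszInt σ (fun t => -obstacle u t) x₀ ≤
        rieszInt σ (fun t => -envelope σ u t) x₀ := by
      refine integral_mono (hb.integrable hn hσ hσ2 x₀) (hw.integrable hn hσ hσ2 x₀) fun t => ?_
      exact mul_le_mul_of_nonneg_right (neg_le_neg (envelope_le hne t)) (by positivity)
    have hb0 : 0 ≤ rieszInt σ (fun t => -obstacle u t) x₀ := hb.rieszInt_nonneg x₀
    calc _ = Real.pi ^ (-(n : ℝ) / 2) / 4 * (ω * Real.exp (-(1 / (4 * lam * ω))) *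
          (-m) ^ (2 / σ) * (1 / (2 * f x₀)) ^ ((2 - σ) / σ)) := by ring
      _ ≤ Real.pi ^ (-(n : ℝ) / 2) / 4 *
          ((2 - σ) * rieszInt σ (fun t => -obstacle u t) x₀) := by gcongr
      _ = Real.pi ^ (-(n : ℝ) / 2) / 4 * (2 - σ) *
          rieszInt σ (fun t => -obstacle u t) x₀ := by ring
      _ ≤ rieszConst n (2 - σ) * rieszInt σ (fun t => -envelope σ u t) x₀ := by
          gcongr
          exact rieszConst_ge hn hσ hσ2
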